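/- **Setting.** Let $\Omega\subseteq\mathbb R^{d}$ be open and bounded, and let $E(\mu)=\sum_j f_j(\mu)E_j$, $A(\mu)=\sum_j g_j(\mu)A_j\in\mathbb R^{n\times n}$, $B(\mu)=\sum_j h_j(\mu)B_j\in\mathbb R^{n\times m}$, $C(\mu)=\sum_j k_j(\mu)C_j\in\mathbb R^{p\times n}$ be finite sums with real matrices $E_j,A_j,B_j,C_j$ and real-analytic functions $f_j,g_j,h_j,k_j:\Omega\to\mathbb R$. Put $D(\mu,s)=sE(\mu)-A(\mu)$ and let $H[\mu](s)=C(\mu)D(\mu,s)^{-1}B(\mu)$, a matrix of rational functions of $s$. For $\omega\in\mathbb R$ let $\sigma(\mu,\omega)$ be the largest singular value of $H[\mu](i\omega)$, and $\sigma(\mu,\infty)=\lim_{|\omega|\to\infty}\sigma(\mu,\omega)$. Write $H[\mu]\in\mathcal H_\infty$ if $sE(\mu)-A(\mu)$ is a regular pencil and $\|H[\mu]\|_{\mathcal H_\infty}:=\sup_{\operatorname{Re}s>0}\|H[\mu](s)\|_2<\infty$. For $V,W\in\mathbb C^{n\times r}$ with orthonormal columns, $D^{V,W}(\mu,s)=W^*D(\mu,s)V$,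 $H^{V,W}[\mu](s)=C(\mu)V\,D^{V,W}(\mu,s)^{-1}\,W^*B(\mu)$, and $\sigma^{V,W}(\mu,\omega)$ is the largest singular value of $H^{V,W}[\mu](i\omega)$. Let $\underline\Omega\subseteq\Omega$ be compact with $H[\mu]\in\mathcal H_\infty$ for all $\mu\in\underline\Omega$. **Algorithms.** Start with subspaces $\mathcal V_0,\mathcal W_0\subseteq\mathbb C^n$ of equal dimension. Throughout, $V_j,W_j$ are matrices with equally many columns, which form orthonormal bases of $\mathcal V_j,\mathcal W_j$. For a pair $(\mu,\omega)$ with $D(\mu,i\omega)$ invertible, *expansion at $(\mu,\omega)$* means adding to $\mathcal V$ the column space of $D(\mu,i\omega)^{-1}B(\mu)$ (if $m\le p$) or of $D(\mu,i\omega)^{-1}B(\mu)H[\mu](i\omega)^*$ (if $m>p$), and to $\mathcal W$ the column space of $D(\mu,i\omega)^{-*}C(\mu)^*$ (if $m\ge p$) or of $D(\mu,i\omega)^{-*}C(\mu)^*H[\mu](i\omega)$ (if $m<p$). *Algorithm 1*, step $j=1,2,\dots$: $\mu^{(j)}$ is a minimizer over $\mu\in\underline\Omega$ of $\sup_{\omega\in\mathbb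 R}\sigma^{V_{j-1},W_{j-1}}(\mu,\omega)$ (which is read as $+\infty$ where the reduced transfer function is undefined or unbounded on the imaginary axis, and has to be finite at $\mu^{(j)}$); $\omega^{(j)}\in\mathbb R$ is a maximizer of $\sigma(\mu^{(j)},\cdot)$ over $\mathbb R\cup\{\infty\}$, with $D(\mu^{(j)},i\omega^{(j)})$ invertible; $\mathcal V_j,\mathcal W_j$ arise from $\mathcal V_{j-1},\mathcal W_{j-1}$ by expansion at $(\mu^{(j)},\omega^{(j)})$. *Algorithm 2* is the same, except that in every step $j\ge2$ the subspaces are in addition expanded at $(\mu^{(j,rq)},\omega^{(j,rq)})$ for all $1\le r\le q\le d$, where $\mu^{(j,rq)}=\mu^{(j)}+\|\mu^{(j)}-\mu^{(j-1)}\|_2\,e_{rq}\in\Omega$, $e_{rr}=e_r$, $e_{rq}=(e_r+e_q)/\sqrt2$ for $r\ne q$, and $\omega^{(j,rq)}\in\mathbb R$ is a maximizer of $\sigma(\mu^{(j,rq)},\cdot)$ over $\mathbb R\cup\{\infty\}$, with $D(\mu^{(j,rq)},i\omega^{(j,rq)})$ invertible. **Assumptions.** Let $\mu_*\in\underline\Omega$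 be a local minimizer of $\|H[\cdot]\|_{\mathcal H_\infty}$ on $\underline\Omega$. Assume that $H[\mu]\in\mathcal H_\infty$ for all $\mu$ in a neighbourhood of $\mu_*$, and that $\sigma$, as a function on $\Omega\times(\mathbb R\cup\{\infty\})$, where $\mathbb R\cup\{\infty\}$ is the one-point compactification, is continuous at $(\mu_*,\omega)$ for every $\omega\in\mathbb R\cup\{\infty\}$. Assume that $\sigma(\mu_*,\cdot)$ attains its maximum over $\mathbb R\cup\{\infty\}$ at a unique point $\omega_*\in\mathbb R$, and that $\sigma(\mu_*,\omega_*)>0$ is a simple singular value of $H[\mu_*](i\omega_*)$. Let $\delta<0<\beta$ be such that $\sigma_{\omega\omega}(\mu_*,\omega_*)\le\delta$ and $\sigma_{\min}(D(\mu_*,i\omega_*))\ge\beta$. Assume that the Hessian $\nabla^2\|H[\mu_*]\|_{\mathcal H_\infty}$ is invertible. Fix $k\ge2$ and a family $\mathcal R$ of runs of $k$ steps, either of Algorithm 1 with $d=1$, or of Algorithm 2, such that within $\mathcal R$ both $\mu^{(k)}\to\mu_*$ and $\mu^{(k-1)}\to\mu_*$ as $\mu^{(1)}\to\mu_*$. **Claim.**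 There are $\zeta,\rho,\eta_\mu,\eta_\omega>0$, the same for all runs, with $\overline{\mathcal B}(\mu_*,\eta_\mu)\subseteq\Omega$, such that the following holds for every run in $\mathcal R$ which satisfies $\|\mu^{(1)}-\mu_*\|_2<\rho$, $\mu^{(k)}\neq\mu^{(k-1)}$, $\sigma^{V_k,W_k}_{\omega\omega}(\mu_*,\omega_*)\le\delta$ and $\sigma_{\min}(D^{V_k,W_k}(\mu_*,i\omega_*))\ge\beta$. The point $\mu^{(k)}$ lies in the interior of $\overline{\mathcal B}(\mu_*,\eta_\mu)$, and there is exactly one continuous function $\boldsymbol\omega^{V_k,W_k}:\overline{\mathcal B}(\mu_*,\eta_\mu)\to[\omega_*-\eta_\omega,\omega_*+\eta_\omega]$ which is three times continuously differentiable in the interior and satisfies $\boldsymbol\omega^{V_k,W_k}(\mu^{(k)})=\omega^{(k)}$ and $\sigma^{V_k,W_k}_\omega(\mu,\boldsymbol\omega^{V_k,W_k}(\mu))=0$ for all $\mu$ in the ball. With $\widetilde\sigma^{V_k,W_k}(\mu):=\sigma^{V_k,W_k}(\mu,\boldsymbol\omega^{V_k,W_k}(\mu))$, the functions $\|H[\cdot]\|_{\mathcal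 H_\infty}$ and $\widetilde\sigma^{V_k,W_k}$ are twice continuously differentiable near $\mu^{(k)}$, and 1. $\big\|\nabla^2\|H[\mu^{(k)}]\|_{\mathcal H_\infty}-\nabla^2\widetilde\sigma^{V_k,W_k}(\mu^{(k)})\big\|_2\le\zeta\,\|\mu^{(k)}-\mu^{(k-1)}\|_2$; 2. both $\nabla^2\|H[\mu^{(k)}]\|_{\mathcal H_\infty}$ and $\nabla^2\widetilde\sigma^{V_k,W_k}(\mu^{(k)})$ are invertible; 3. $\big\|[\nabla^2\|H[\mu^{(k)}]\|_{\mathcal H_\infty}]^{-1}-[\nabla^2\widetilde\sigma^{V_k,W_k}(\mu^{(k)})]^{-1}\big\|_2\le\zeta\,\|\mu^{(k)}-\mu^{(k-1)}\|_2$. -/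

import Mathlib

open Set Filter Topology
open scoped Matrix Matrix.Norms.L2Operator OnePoint

noncomputable section

namespace HinfMin

/-- The parameter space `ℝ^d` with the Euclidean norm. -/
abbrev Param (d : ℕ) : Type := EuclideanSpace ℝ (Fin d)

/-! ### Singular values, column spaces, Hessians -/

/-- The largest singular value of a complex matrix. -/
def sigmaMax {a b : ℕ} (M : Matrix (Fin a) (Fin b) ℂ) : ℝ :=
  (Matrix.toEuclideanLin M).singularValues 0

/-- The second largest singular value, counted with multiplicity
(`0` if there is only one singular value). -/
def sigmaSecond {a b : ℕ} (M : Matrix (Fin a) (Fin b) ℂ) : ℝ :=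
  (Matrix.toEuclideanLin M).singularValues 1

/-- The smallest singular value of a square complex matrix. -/
def sigmaMin {a : ℕ} (M : Matrix (Fin a) (Fin a) ℂ) : ℝ :=
  (Matrix.toEuclideanLin M).singularValues (a - 1)

/-- The column space of a matrix. -/
def colSpace {a b : ℕ} (M : Matrix (Fin a) (Fin b) ℂ) : Submodule ℂ (Fin a → ℂ) :=
  LinearMap.range M.mulVecLin

/-- The Hessian matrix of a function of `d` real variables. -/
def hessian {d : ℕ} (F : Param d → ℝ) (x : Param d) : Matrix (Fin d) (Fin d) ℝ :=
  Matrix.of fun i j =>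
    iteratedFDeriv ℝ 2 F x ![EuclideanSpace.single i (1 : ℝ), EuclideanSpace.single j (1 : ℝ)]

/-! ### Descriptor systems and their transfer functions -/

/-- The coefficient matrices of one (complex) descriptor system
`E x' = A x + B u`, `y = C x` with `r` states, `m` inputs and `p` outputs. -/
structure Descriptor (r m p : ℕ) where
  E : Matrix (Fin r) (Fin r) ℂ
  A : Matrix (Fin r) (Fin r) ℂ
  B : Matrix (Fin r) (Fin m) ℂ
  C : Matrix (Fin p) (Fin r) ℂ

namespace Descriptor

variable {r m p : ℕ} (P : Descriptor r m p)

/-- `D(s) = s E - A`. -/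
def D (s : ℂ) : Matrix (Fin r) (Fin r) ℂ := s • P.E - P.A

/-- The pencil `s E - A` is regular. -/
def IsRegular : Prop := ∃ s : ℂ, (P.D s).det ≠ 0

/-- The transfer function `C (s E - A)⁻¹ B`, a matrix of rational functions of `s`
(meaningful for regular pencils). -/
def transfer : Matrix (Fin p) (Fin m) (RatFunc ℂ) :=
  P.C.map RatFunc.C * ((RatFunc.X : RatFunc ℂ) • P.E.map RatFunc.C - P.A.map RatFunc.C)⁻¹ * P.B.map RatFunc.C

/-- The value `H(s)` of the transfer function at a complex number `s`. The entries are evaluated as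
reduced fractions, so removable singularities are removed. -/
def H (s : ℂ) : Matrix (Fin p) (Fin m) ℂ :=
  P.transfer.map (RatFunc.eval (RingHom.id ℂ) s)

/-- `σ(ω)`: the largest singular value of `H(iω)`. -/
def sigma (ω : ℝ) : ℝ := sigmaMax (P.H (Complex.I * ω))

/-- `σ` on `ℝ ∪ {∞}`; the value at `∞` is the limit of `σ(ω)` for `|ω| → ∞`, which exists
for every transfer function that is bounded on the imaginary axis. -/
def sigmaExt (ω : OnePoint ℝ) : ℝ :=
  ω.elim (limUnder (cocompact ℝ) P.sigma) P.sigma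

/-- `ω` is a real number which maximizes `σ` over `ℝ ∪ {∞}`. -/
def IsPeak (ω : ℝ) : Prop := ∀ ω' : OnePoint ℝ, P.sigmaExt ω' ≤ P.sigma ω

/-- The transfer function is well defined and bounded in the open right half plane:
it belongs to `H_∞`. -/
def IsHinf : Prop :=
  P.IsRegular ∧ BddAbove (range fun s : {s : ℂ // 0 < s.re} => ‖P.H s‖)

/-- The `H_∞`-norm of a transfer function in `H_∞`; `‖·‖` is the spectral norm. -/
def hinfNorm : ℝ := ⨆ s : {s : ℂ // 0 < s.re}, ‖P.H s‖

open Classical in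
/-- The `L_∞`-norm as an extended number; it is finite exactly for those systems whose transfer
function is well defined and bounded on the imaginary axis. -/
def linfNorm : ENNReal :=
  if P.IsRegular then ⨆ ω : ℝ, ENNReal.ofReal (P.sigma ω) else ⊤

/-- The column space of the matrix which expands the right subspace at the frequency `ω`:
`D(iω)⁻¹ B` if `m ≤ p`, and `D(iω)⁻¹ B H(iω)^*` if `m > p`. -/
def expandV (ω : ℝ) : Submodule ℂ (Fin r → ℂ) :=
  if m ≤ p then colSpace ((P.D (Complex.I * ω))⁻¹ * P.B)
  else colSpace ((P.D (Complex.I * ω))⁻¹ * P.B * (P.H (Complex.I * ω))ᴴ)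

/-- The column space of the matrix which expands the left subspace at the frequency `ω`:
`D(iω)^{-*} C^*` if `m ≥ p`, and `D(iω)^{-*} C^* H(iω)` if `m < p`. -/
def expandW (ω : ℝ) : Submodule ℂ (Fin r → ℂ) :=
  if p ≤ m then colSpace (((P.D (Complex.I * ω))⁻¹)ᴴ * P.Cᴴ)
  else colSpace (((P.D (Complex.I * ω))⁻¹)ᴴ * P.Cᴴ * P.H (Complex.I * ω))

end Descriptor

/-! ### Parameter-dependent systems and their reductions -/

/-- The data of a parameter-dependent descriptor system
`E(μ) = ∑ f_j(μ) E_j`, `A(μ) = ∑ g_j(μ) A_j`, `B(μ) = ∑ h_j(μ) B_j`, `C(μ) = ∑ k_j(μ) C_j`. -/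
structure ParamSystem (d n m p : ℕ) where
  κE : ℕ
  κA : ℕ
  κB : ℕ
  κC : ℕ
  f : Fin κE → Param d → ℝ
  g : Fin κA → Param d → ℝ
  h : Fin κB → Param d → ℝ
  k : Fin κC → Param d → ℝ
  E : Fin κE → Matrix (Fin n) (Fin n) ℝ
  A : Fin κA → Matrix (Fin n) (Fin n) ℝ
  B : Fin κB → Matrix (Fin n) (Fin m) ℝ
  C : Fin κC → Matrix (Fin p) (Fin n) ℝ

namespace ParamSystem

variable {d n m p : ℕ} (S : ParamSystem d n m p)

/-- All coefficient functions are real analytic on the (open) set `Ω`. -/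
def IsAnalytic (Ω : Set (Param d)) : Prop :=
  (∀ j, AnalyticOnNhd ℝ (S.f j) Ω) ∧ (∀ j, AnalyticOnNhd ℝ (S.g j) Ω) ∧
  (∀ j, AnalyticOnNhd ℝ (S.h j) Ω) ∧ (∀ j, AnalyticOnNhd ℝ (S.k j) Ω)

/-- The full system at the parameter `μ`. -/
def full (μ : Param d) : Descriptor n m p where
  E := ∑ j, (S.f j μ : ℂ) • (S.E j).map Complex.ofReal
  A := ∑ j, (S.g j μ : ℂ) • (S.A j).map Complex.ofReal
  B := ∑ j, (S.h j μ : ℂ) • (S.B j).map Complex.ofReal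
  C := ∑ j, (S.k j μ : ℂ) • (S.C j).map Complex.ofReal

/-- The system at the parameter `μ`, reduced by means of the matrices `V` and `W`. -/
def reduced {r : ℕ} (V W : Matrix (Fin n) (Fin r) ℂ) (μ : Param d) : Descriptor r m p where
  E := ∑ j, (S.f j μ : ℂ) • (Wᴴ * (S.E j).map Complex.ofReal * V)
  A := ∑ j, (S.g j μ : ℂ) • (Wᴴ * (S.A j).map Complex.ofReal * V)
  B := ∑ j, (S.h j μ : ℂ) • (Wᴴ * (S.B j).map Complex.ofReal)
  C := ∑ j, (S.k j μ : ℂ) • ((S.C j).map Complex.ofReal * V)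

end ParamSystem

/-! ### The two greedy algorithms -/

/-- The quantities which occur in a run of one of the algorithms: the iterates `μ^(j)` and `ω^(j)`
for `j ≥ 1`, the bases `V_j`, `W_j` for `j ≥ 0`, and the frequencies `ω^(j,rq)`,
which only the extended algorithm uses. -/
structure Run (d n : ℕ) where
  μ : ℕ → Param d
  ω : ℕ → ℝ
  dim : ℕ → ℕ
  V : (j : ℕ) → Matrix (Fin n) (Fin (dim j)) ℂ
  W : (j : ℕ) → Matrix (Fin n) (Fin (dim j)) ℂ
  ωAdj : ℕ → Fin d → Fin d → ℝ

/-- `e_{rq} = (e_r + e_q) / √2` for `r ≠ q`, and `e_{rr} = e_r`. -/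
def eDir {d : ℕ} (r q : Fin d) : Param d :=
  if r = q then EuclideanSpace.single r (1 : ℝ)
  else (1 / √2 : ℝ) • (EuclideanSpace.single r (1 : ℝ) + EuclideanSpace.single q (1 : ℝ))

/-- The point `μ^(j+1,rq) = μ^(j+1) + ‖μ^(j+1) - μ^(j)‖ e_{rq}`. -/
def Run.adjacent {d n : ℕ} (R : Run d n) (j : ℕ) (r q : Fin d) : Param d :=
  R.μ (j + 1) + ‖R.μ (j + 1) - R.μ j‖ • eDir r q

variable {d n m p : ℕ}

/-- The columns of `V_j` and of `W_j` are orthonormal for all `j ≤ K`. -/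
def Run.Orthonormal (R : Run d n) (K : ℕ) : Prop :=
  ∀ j ≤ K, (R.V j)ᴴ * R.V j = 1 ∧ (R.W j)ᴴ * R.W j = 1

/-- Step `j + 1` computes `μ^(j+1)` and `ω^(j+1)`: `μ^(j+1)` minimizes the norm of the
transfer function reduced to `V_j`, `W_j` over `Ωc`, and `ω^(j+1)` maximizes `σ(μ^(j+1), ·)`. -/
structure Run.Iterate (S : ParamSystem d n m p) (Ωc : Set (Param d)) (R : Run d n) (j : ℕ) :
    Prop where
  mem : R.μ (j + 1) ∈ Ωc
  finite : (S.reduced (R.V j) (R.W j) (R.μ (j + 1))).linfNorm ≠ ⊤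
  minimal : IsMinOn (fun ν => (S.reduced (R.V j) (R.W j) ν).linfNorm) Ωc (R.μ (j + 1))
  invertible : IsUnit ((S.full (R.μ (j + 1))).D (Complex.I * R.ω (j + 1)))
  peak : (S.full (R.μ (j + 1))).IsPeak (R.ω (j + 1))

/-- `R` consists of `K` steps of the basic greedy algorithm. -/
structure IsBasicRun (S : ParamSystem d n m p) (Ωc : Set (Param d)) (K : ℕ) (R : Run d n) :
    Prop where
  orthonormal : R.Orthonormal K
  iterate : ∀ j < K, R.Iterate S Ωc j
  expandV : ∀ j < K, colSpace (R.V (j + 1)) =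
    colSpace (R.V j) ⊔ (S.full (R.μ (j + 1))).expandV (R.ω (j + 1))
  expandW : ∀ j < K, colSpace (R.W (j + 1)) =
    colSpace (R.W j) ⊔ (S.full (R.μ (j + 1))).expandW (R.ω (j + 1))

/-- `R` consists of `K` steps of the extended greedy algorithm: from the second step on, the
subspaces are also expanded at the points `μ^(j+1,rq)`, `r ≤ q`. -/
structure IsExtendedRun (S : ParamSystem d n m p) (Ω Ωc : Set (Param d)) (K : ℕ) (R : Run d n) :
    Prop where
  orthonormal : R.Orthonormal K
  iterate : ∀ j < K, R.Iterate S Ωc j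
  adjacent_mem : ∀ j < K, 1 ≤ j → ∀ r q : Fin d, r ≤ q → R.adjacent j r q ∈ Ω
  adjacent_invertible : ∀ j < K, 1 ≤ j → ∀ r q : Fin d, r ≤ q →
    IsUnit ((S.full (R.adjacent j r q)).D (Complex.I * R.ωAdj (j + 1) r q))
  adjacent_peak : ∀ j < K, 1 ≤ j → ∀ r q : Fin d, r ≤ q →
    (S.full (R.adjacent j r q)).IsPeak (R.ωAdj (j + 1) r q)
  expandV : ∀ j < K, colSpace (R.V (j + 1)) =
    colSpace (R.V j) ⊔ (S.full (R.μ (j + 1))).expandV (R.ω (j + 1)) ⊔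
      ⨆ (_ : 1 ≤ j) (r : Fin d) (q : Fin d) (_ : r ≤ q),
        (S.full (R.adjacent j r q)).expandV (R.ωAdj (j + 1) r q)
  expandW : ∀ j < K, colSpace (R.W (j + 1)) =
    colSpace (R.W j) ⊔ (S.full (R.μ (j + 1))).expandW (R.ω (j + 1)) ⊔
      ⨆ (_ : 1 ≤ j) (r : Fin d) (q : Fin d) (_ : r ≤ q),
        (S.full (R.adjacent j r q)).expandW (R.ωAdj (j + 1) r q)

/-! ### The frequency branch of the reduced system -/

/-- `w` is a continuous function from the closed ball of radius `ημ` around `μs` to the closed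
interval of radius `ηω` around `ωs` which is three times continuously differentiable in the interior
of the ball, takes the value `ωk` at `μk`, and satisfies `s_ω(μ, w(μ)) = 0` in the whole ball. -/
structure IsFrequencyBranch (s : Param d → ℝ → ℝ) (μs : Param d) (ωs ημ ηω : ℝ)
    (μk : Param d) (ωk : ℝ) (w : Param d → ℝ) : Prop where
  continuousOn : ContinuousOn w (Metric.closedBall μs ημ)
  mapsTo : MapsTo w (Metric.closedBall μs ημ) (Metric.closedBall ωs ηω)
  contDiffOn : ContDiffOn ℝ 3 w (interior (Metric.closedBall μs ημ))
  value : w μk = ωk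
  stationary : ∀ μ ∈ Metric.closedBall μs ημ, HasDerivAt (s μ) 0 (w μ)

end HinfMin

end

/-! Near `μs` the H-infinity norm is the smooth function `F₀(μ) = σ(μ, G μ)`: the largest singular
value is simple and positive at the peak, hence smooth, and the implicit function theorem applied to
`σ_ω = 0` gives the peak frequency `G`. Joint continuity on the compactified frequency line keeps
all other frequencies strictly below the peak. The bases `θ = (V, W)` are treated as one more
variable. The reduced singular value is jointly smooth in `(θ, μ, ω)` wherever the norm is smooth at
the reduced transfer value and the reduced pencil is invertible, and it has its own stationary
branch `g(θ, μ)`. Put `f(θ, μ) = σ_θ(μ, g(θ, μ)) - F₀(μ)`. Expansion at `(μ, G μ)` makes the reduced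
and the full singular value agree there together with their gradients (`Contains.interpolates`).
Hence `G μ` is stationary for the reduced problem too, so `g(θ, μ) = G μ`, and `f(θ, ·)` vanishes at
`μ` with its gradient. It also vanishes at the adjacent points, whose distance from `μ` is
proportional to `h = ‖μ^(k) - μ^(k-1)‖`. In one parameter the previous iterate plays the role of the
adjacent point. Taylor's formula with a Lipschitz second derivative then bounds the second
derivative along each direction `e_rq` by a multiple of `h`, and polarization bounds the whole
Hessian of `f(θ, ·)`, which is the Hessian error (`norm_hessian_le_of_vanishing`). Uniformity over
all runs comes from compactness: orthonormal bases with the lower bound `β` on the reduced pencil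
form a compact set for each dimension `r ≤ n`. Local constants exist around every point of it
(`eventually_hasHessianBound`); near bases that cannot interpolate the claim is vacuous.
Invertibility and the bound for the inverses follow by perturbation from the invertible Hessian at
`μs`. -/

namespace HinfMin

/-! ### Taylor estimate with vanishing data, and stationary branches -/

section Calculus

variable {E : Type*} [NormedAddCommGroup E] [NormedSpace ℝ E]

/-- Along the segment, `f (x + t v)` differs from its second-order Taylor polynomial by `O(‖v‖³)`,
because the second derivative is Lipschitz. Only the quadratic term of that polynomial is left, and
it must cancel against the remainder at `t = 1`. The constants depend on `x₀` only, not on `x` or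
`v`. -/
theorem abs_fderiv_fderiv_le_of_vanishing {f : E → ℝ} {x₀ : E} (hf : ContDiffAt ℝ 3 f x₀) :
    ∃ L : ℝ, 0 ≤ L ∧ ∃ ε > 0, ∀ x v : E, x ∈ Metric.ball x₀ ε → x + v ∈ Metric.ball x₀ ε →
      f x = 0 → f (x + v) = 0 → fderiv ℝ f x v = 0 →
      |fderiv ℝ (fderiv ℝ f) x v v| ≤ L * ‖v‖ ^ 3 := by
  have h1 : ContDiffAt ℝ 2 (fderiv ℝ f) x₀ := hf.fderiv_right (by norm_num)
  have h2 : ContDiffAt ℝ 1 (fderiv ℝ (fderiv ℝ f)) x₀ := h1.fderiv_right (by norm_num)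
  obtain ⟨K, t, ht, hK⟩ := h2.exists_lipschitzOnWith
  have e1 : ∀ᶠ x in 𝓝 x₀, ContDiffAt ℝ 3 f x := hf.eventually (by simp)
  have e2 : ∀ᶠ x in 𝓝 x₀, ContDiffAt ℝ 2 (fderiv ℝ f) x := h1.eventually (by simp)
  obtain ⟨ε, hε, hball⟩ := Metric.mem_nhds_iff.1 (Filter.inter_mem ht (e1.and e2))
  refine ⟨2 * K, by positivity, ε, hε, fun x v hx hxv h0 h0v hd => ?_⟩
  have hseg : ∀ t ∈ Icc (0 : ℝ) 1, x + t • v ∈ Metric.ball x₀ ε := by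
    intro t ht
    have := (convex_ball x₀ ε).add_smul_sub_mem hx hxv ht
    simpa using this
  set c : ℝ := fderiv ℝ (fderiv ℝ f) x v v with hc
  have hline : ∀ t : ℝ, HasDerivAt (fun t : ℝ => x + t • v) v t := by
    intro t
    simpa using ((hasDerivAt_id t).smul_const v).const_add x
  have d1 : ∀ t ∈ Icc (0 : ℝ) 1, HasDerivAt (fun t => f (x + t • v)) (fderiv ℝ f (x + t • v) v) t := by
    intro t ht
    have := ((hball (hseg t ht)).2.1.differentiableAt (by simp)).hasFDerivAt
    exact this.comp_hasDerivAt t (hline t)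
  have d2 : ∀ t ∈ Icc (0 : ℝ) 1, HasDerivAt (fun t => fderiv ℝ f (x + t • v) v)
      (fderiv ℝ (fderiv ℝ f) (x + t • v) v v) t := by
    intro t ht
    have := ((hball (hseg t ht)).2.2.differentiableAt (by simp)).hasFDerivAt
    have h3 := this.comp_hasDerivAt t (hline t)
    have h4 := h3.clm_apply (hasDerivAt_const t v)
    simpa using h4
  have b2 : ∀ t ∈ Icc (0 : ℝ) 1, |fderiv ℝ (fderiv ℝ f) (x + t • v) v v - c| ≤ K * ‖v‖ ^ 3 := by
    intro t ht
    have h5 := hK.dist_le_mul _ (hball (hseg t ht)).1 _ (hball hx).1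
    rw [dist_eq_norm, dist_eq_norm] at h5
    have h6 : ‖x + t • v - x‖ ≤ ‖v‖ := by
      rw [add_sub_cancel_left, norm_smul, Real.norm_of_nonneg ht.1]
      exact mul_le_of_le_one_left (norm_nonneg _) ht.2
    have h7 : |fderiv ℝ (fderiv ℝ f) (x + t • v) v v - c| ≤
        ‖fderiv ℝ (fderiv ℝ f) (x + t • v) - fderiv ℝ (fderiv ℝ f) x‖ * ‖v‖ * ‖v‖ := by
      have := (fderiv ℝ (fderiv ℝ f) (x + t • v) - fderiv ℝ (fderiv ℝ f) x).le_opNorm₂ v v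
      simpa [hc, Real.norm_eq_abs] using this
    calc _ ≤ _ := h7
      _ ≤ (K * ‖v‖) * ‖v‖ * ‖v‖ := by
        gcongr
        exact h5.trans (by gcongr)
      _ = _ := by ring
  -- The mean value inequality, used here and again in `b0`, integrates `b2` twice starting from the
  -- vanishing data at `t = 0`.
  have b1 : ∀ t ∈ Icc (0 : ℝ) 1, |fderiv ℝ f (x + t • v) v - t * c| ≤ K * ‖v‖ ^ 3 := by
    intro t ht
    have hder : ∀ s ∈ Icc (0 : ℝ) 1, HasDerivAt (fun t => fderiv ℝ f (x + t • v) v - t * c)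
        (fderiv ℝ (fderiv ℝ f) (x + s • v) v v - c) s := by
      intro s hs
      have := (d2 s hs).sub ((hasDerivAt_id s).mul_const c)
      rwa [one_mul] at this
    have := norm_image_sub_le_of_norm_deriv_le_segment'
      (fun s hs => (hder s hs).hasDerivWithinAt) (fun s hs => by
        rw [Real.norm_eq_abs]; exact b2 s (Ico_subset_Icc_self hs)) t ht
    simp only [zero_smul, add_zero, hd, zero_mul, sub_zero, Real.norm_eq_abs] at this
    refine this.trans (mul_le_of_le_one_right (by positivity) ht.2)
  have b0 : |f (x + (1 : ℝ) • v) - 1 ^ 2 / 2 * c| ≤ K * ‖v‖ ^ 3 := by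
    have hder : ∀ s ∈ Icc (0 : ℝ) 1, HasDerivAt (fun t => f (x + t • v) - t ^ 2 / 2 * c)
        (fderiv ℝ f (x + s • v) v - s * c) s := by
      intro s hs
      have := (d1 s hs).sub ((((hasDerivAt_id s).pow 2).div_const 2).mul_const c)
      convert! this using 1
      simp
    have := norm_image_sub_le_of_norm_deriv_le_segment'
      (fun s hs => (hder s hs).hasDerivWithinAt) (fun s hs => by
        rw [Real.norm_eq_abs]; exact b1 s (Ico_subset_Icc_self hs)) 1 (by simp)
    simpa [h0, Real.norm_eq_abs] using this
  rw [one_smul, h0v] at b0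
  have : |0 - 1 ^ 2 / 2 * c| = |c| / 2 := by
    rw [zero_sub, abs_neg, abs_mul]; norm_num; ring
  rw [this] at b0
  linarith

/-- The implicit function theorem is applied to `Ψ = ∂Φ/∂ω`, which loses one derivative. On a box
where `∂Ψ/∂ω < 0`, `Ψ` is strictly decreasing in `ω`, so its zero is unique in the whole interval
and is a strict maximum of `Φ`. The interval radius `η` does not depend on `x`; uniqueness in it
later identifies different branches with each other. -/
theorem exists_stationary_branch [CompleteSpace E] {Φ : E × ℝ → ℝ} {x₀ : E} {ω₀ : ℝ}
    (hΦ : ContDiffAt ℝ 4 Φ (x₀, ω₀)) (h1 : HasDerivAt (fun ω => Φ (x₀, ω)) 0 ω₀)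
    (h2 : iteratedDeriv 2 (fun ω => Φ (x₀, ω)) ω₀ < 0) :
    ∃ g : E → ℝ, ContDiffAt ℝ 3 g x₀ ∧ g x₀ = ω₀ ∧ ∀ᶠ η in 𝓝[>] (0 : ℝ), ∀ᶠ x in 𝓝 x₀,
      g x ∈ Metric.ball ω₀ η ∧ ContDiffAt ℝ 3 g x ∧ ContDiffAt ℝ 4 Φ (x, g x) ∧
      HasDerivAt (fun ω => Φ (x, ω)) 0 (g x) ∧
      (∀ ω ∈ Metric.closedBall ω₀ η, HasDerivAt (fun ω => Φ (x, ω)) 0 ω → ω = g x) ∧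
      (∀ ω ∈ Metric.closedBall ω₀ η, ω ≠ g x → Φ (x, ω) < Φ (x, g x)) := by
  set Ψ : E × ℝ → ℝ := fun y => fderiv ℝ Φ y (0, 1) with hΨ
  set χ : E × ℝ → ℝ := fun y => fderiv ℝ Ψ y (0, 1) with hχ
  have cΨ : ContDiffAt ℝ 3 Ψ (x₀, ω₀) :=
    (hΦ.fderiv_right (m := 3) (by norm_num)).clm_apply contDiffAt_const
  have cχ : ContDiffAt ℝ 2 χ (x₀, ω₀) :=
    (cΨ.fderiv_right (m := 2) (by norm_num)).clm_apply contDiffAt_const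
  have hline : ∀ y : E × ℝ, HasDerivAt (fun t : ℝ => (y.1, t)) ((0 : E), (1 : ℝ)) y.2 := fun y =>
    (hasDerivAt_const _ _).prodMk (hasDerivAt_id _)
  have dΦ : ∀ y, ContDiffAt ℝ 4 Φ y → HasDerivAt (fun ω => Φ (y.1, ω)) (Ψ y) y.2 := fun y hy =>
    (hy.differentiableAt (by simp)).hasFDerivAt.comp_hasDerivAt y.2 (hline y)
  have dΨ : ∀ y, ContDiffAt ℝ 3 Ψ y → HasDerivAt (fun ω => Ψ (y.1, ω)) (χ y) y.2 := fun y hy =>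
    HasFDerivAt.comp_hasDerivAt (l := Ψ) y.2 (hy.differentiableAt (by simp)).hasFDerivAt (hline y)
  have evΦ : ∀ᶠ y in 𝓝 (x₀, ω₀), ContDiffAt ℝ 4 Φ y := hΦ.eventually (by simp)
  have evΨ : ∀ᶠ y in 𝓝 (x₀, ω₀), ContDiffAt ℝ 3 Ψ y := cΨ.eventually (by simp)
  have hΨ0 : Ψ (x₀, ω₀) = 0 := (dΦ _ hΦ).unique h1
  have hχ0 : χ (x₀, ω₀) < 0 := by
    rw [iteratedDeriv_succ, iteratedDeriv_one] at h2
    have : deriv (fun ω => Φ (x₀, ω)) =ᶠ[𝓝 ω₀] fun ω => Ψ (x₀, ω) := by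
      have := (Continuous.prodMk_right (X := E) (Y := ℝ) x₀).tendsto ω₀ |>.eventually evΦ
      filter_upwards [this] with ω hω
      exact (dΦ _ hω).deriv
    rw [this.deriv_eq, (dΨ (x₀, ω₀) cΨ).deriv] at h2
    exact h2
  have evχ : ∀ᶠ y in 𝓝 (x₀, ω₀), χ y < 0 := cχ.continuousAt.eventually_lt_const hχ0
  have hinv : (fderiv ℝ Ψ (x₀, ω₀) ∘L .inr ℝ E ℝ).IsInvertible := by
    refine ⟨ContinuousLinearEquiv.unitsEquivAut ℝ (Units.mk0 (χ (x₀, ω₀)) hχ0.ne), ?_⟩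
    ext
    simp [hχ]
  set g := cΨ.implicitFunction (by simp) hinv with hg
  have g0 : g x₀ = ω₀ := cΨ.implicitFunction_apply_self (by simp) hinv
  have gc : ContDiffAt ℝ 3 g x₀ := cΨ.contDiffAt_implicitFunction (by simp) hinv
  have gz : ∀ᶠ x in 𝓝 x₀, Ψ (x, g x) = 0 := by
    have := cΨ.eventually_apply_implicitFunction (by simp) hinv
    simpa [hΨ0] using this
  refine ⟨g, gc, g0, ?_⟩
  obtain ⟨ε, hε, hbox⟩ := Metric.mem_nhds_iff.1 ((evΦ.and evΨ).and evχ)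
  rw [← ball_prod_same] at hbox
  filter_upwards [Ioo_mem_nhdsGT hε] with η hη
  have hgη : ∀ᶠ x in 𝓝 x₀, g x ∈ Metric.ball ω₀ η :=
    gc.continuousAt.eventually_mem (by rw [g0]; exact Metric.ball_mem_nhds _ hη.1)
  filter_upwards [gz, hgη, gc.eventually (by simp), Metric.ball_mem_nhds x₀ hε] with x hz hgx hgc hx
  have hmem : ∀ ω ∈ Metric.closedBall ω₀ η, ω ∈ Metric.ball ω₀ ε := fun ω hω =>
    Metric.closedBall_subset_ball hη.2 hω
  have hB : ∀ ω ∈ Metric.closedBall ω₀ η,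
      (ContDiffAt ℝ 4 Φ (x, ω) ∧ ContDiffAt ℝ 3 Ψ (x, ω)) ∧ χ (x, ω) < 0 :=
    fun ω hω => hbox ⟨hx, hmem ω hω⟩
  have hgx' := Metric.ball_subset_closedBall hgx
  have hconv : Convex ℝ (Metric.closedBall ω₀ η) := convex_closedBall _ _
  have hanti : StrictAntiOn (fun ω => Ψ (x, ω)) (Metric.closedBall ω₀ η) := by
    refine strictAntiOn_of_deriv_neg hconv (fun ω hω =>
      (dΨ (x, ω) (hB ω hω).1.2).continuousAt.continuousWithinAt) fun ω hω => ?_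
    have hω := interior_subset hω
    rw [(dΨ (x, ω) (hB ω hω).1.2).deriv]
    exact (hB ω hω).2
  have hzero : HasDerivAt (fun ω => Φ (x, ω)) 0 (g x) := by
    have := dΦ (x, g x) (hB _ hgx').1.1
    rwa [hz] at this
  refine ⟨hgx, hgc, (hB _ hgx').1.1, hzero, fun ω hω hd => ?_, fun ω hω hne => ?_⟩
  · have h3 : Ψ (x, ω) = 0 := (dΦ (x, ω) (hB ω hω).1.1).unique hd
    exact hanti.injOn hω hgx' (by simp only [h3, hz])
  · have hsub : ∀ a b, a ∈ Metric.closedBall ω₀ η → b ∈ Metric.closedBall ω₀ η →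
        Icc a b ⊆ Metric.closedBall ω₀ η := fun a b ha hb => hconv.ordConnected.out ha hb
    rcases lt_or_gt_of_ne hne with hlt | hgt
    · have hs := hsub _ _ hω hgx'
      obtain ⟨ξ, hξ, he⟩ := exists_hasDerivAt_eq_slope (fun ω => Φ (x, ω)) (fun ω => Ψ (x, ω)) hlt
        (fun a ha => (dΦ (x, a) (hB a (hs ha)).1.1).continuousAt.continuousWithinAt)
        (fun a ha => dΦ (x, a) (hB a (hs (Ioo_subset_Icc_self ha))).1.1)
      have h3 := hanti (hs (Ioo_subset_Icc_self hξ)) hgx' hξ.2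
      simp only [hz] at h3
      rw [he, div_pos_iff_of_pos_right (by linarith)] at h3
      linarith
    · have hs := hsub _ _ hgx' hω
      obtain ⟨ξ, hξ, he⟩ := exists_hasDerivAt_eq_slope (fun ω => Φ (x, ω)) (fun ω => Ψ (x, ω)) hgt
        (fun a ha => (dΦ (x, a) (hB a (hs ha)).1.1).continuousAt.continuousWithinAt)
        (fun a ha => dΦ (x, a) (hB a (hs (Ioo_subset_Icc_self ha))).1.1)
      have h3 := hanti hgx' (hs (Ioo_subset_Icc_self hξ)) hξ.1
      simp only [hz] at h3
      rw [he, div_lt_iff₀ (by linarith)] at h3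
      linarith

end Calculus

/-! ### Hessians, slices in the parameter, and polarization -/

section Hessian

variable {d : ℕ} {T : Type*} [NormedAddCommGroup T] [NormedSpace ℝ T]

theorem hessian_apply {F : Param d → ℝ} {x : Param d} (i j : Fin d) :
    hessian F x i j = fderiv ℝ (fderiv ℝ F) x (EuclideanSpace.single i 1)
      (EuclideanSpace.single j 1) := by
  simp [hessian, iteratedFDeriv_two_apply]

theorem hessian_sub {F G : Param d → ℝ} {x : Param d} (hF : ContDiffAt ℝ 2 F x)
    (hG : ContDiffAt ℝ 2 G x) :
    hessian (fun y => F y - G y) x = hessian F x - hessian G x := by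
  have h : fderiv ℝ (fun y => F y - G y) =ᶠ[𝓝 x] fun y => fderiv ℝ F y - fderiv ℝ G y := by
    filter_upwards [hF.eventually (by simp), hG.eventually (by simp)] with y hy hy'
    exact fderiv_fun_sub (hy.differentiableAt (by simp)) (hy'.differentiableAt (by simp))
  ext i j
  rw [Matrix.sub_apply, hessian_apply, hessian_apply, hessian_apply, h.fderiv_eq,
    fderiv_fun_sub ((hF.fderiv_right (m := 1) (by norm_num)).differentiableAt (by simp))
      ((hG.fderiv_right (m := 1) (by norm_num)).differentiableAt (by simp))]
  rfl

theorem hessian_congr {F G : Param d → ℝ} {x : Param d} (h : F =ᶠ[𝓝 x] G) :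
    hessian F x = hessian G x := by
  ext i j
  rw [hessian_apply, hessian_apply, h.fderiv.fderiv_eq]

theorem hasFDerivAt_slice {F : Type*} [NormedAddCommGroup F] [NormedSpace ℝ F]
    {f : T × Param d → F} {θ : T} {μ : Param d} (hf : DifferentiableAt ℝ f (θ, μ)) :
    HasFDerivAt (fun ν => f (θ, ν)) (fderiv ℝ f (θ, μ) ∘L .inr ℝ T (Param d)) μ :=
  hf.hasFDerivAt.comp μ (hasFDerivAt_prodMk_right θ μ)

theorem hessian_slice {f : T × Param d → ℝ} {θ : T} {μ : Param d} (hf : ContDiffAt ℝ 2 f (θ, μ))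
    (i j : Fin d) :
    hessian (fun ν => f (θ, ν)) μ i j = fderiv ℝ (fderiv ℝ f) (θ, μ)
      (0, EuclideanSpace.single i 1) (0, EuclideanSpace.single j 1) := by
  have h : fderiv ℝ (fun ν => f (θ, ν)) =ᶠ[𝓝 μ] fun ν =>
      fderiv ℝ f (θ, ν) ∘L .inr ℝ T (Param d) := by
    have := (Continuous.prodMk_right (X := T) (Y := Param d) θ).tendsto μ |>.eventually
      (hf.eventually (by simp))
    filter_upwards [this] with ν hν
    exact (hasFDerivAt_slice (hν.differentiableAt (by simp))).fderiv
  have h2 := hasFDerivAt_slice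
    ((hf.fderiv_right (m := 1) (by norm_num)).differentiableAt (by simp))
  rw [hessian_apply, h.fderiv_eq, (h2.clm_comp (hasFDerivAt_const _ _)).fderiv]
  simp

/-- A crude bound, sufficient because it only enters constants. -/
theorem norm_eDir_le {d : ℕ} (r q : Fin d) : ‖eDir r q‖ ≤ 2 := by
  unfold eDir
  split_ifs
  · simp
  · rw [norm_smul]
    have h1 : ‖(1 / √2 : ℝ)‖ ≤ 1 := by
      rw [Real.norm_of_nonneg (by positivity), div_le_one (by positivity)]
      exact Real.one_le_sqrt.2 (by norm_num)
    have h2 : ‖(EuclideanSpace.single r (1 : ℝ) + EuclideanSpace.single q (1 : ℝ) : Param d)‖ ≤ 2 :=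
      (norm_add_le _ _).trans (by simp; norm_num)
    nlinarith [norm_nonneg (1 / √2 : ℝ)]

/-- Polarization: `B(e_rq, e_rq)` is half of `B_rr + 2 B_rq + B_qq`, so the diagonal entries and
these values determine `B`. -/
theorem abs_le_of_eDir {B : Param d →L[ℝ] Param d →L[ℝ] ℝ} (hB : ∀ x y, B x y = B y x) {c : ℝ}
    (hc : ∀ r q : Fin d, r ≤ q → |B (eDir r q) (eDir r q)| ≤ c) (i j : Fin d) :
    |B (EuclideanSpace.single i 1) (EuclideanSpace.single j 1)| ≤ 2 * c := by
  have hdiag : ∀ i, |B (EuclideanSpace.single i 1) (EuclideanSpace.single i 1)| ≤ c := by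
    intro i
    simpa [eDir] using hc i i le_rfl
  have key : ∀ i j : Fin d, i < j →
      |B (EuclideanSpace.single i 1) (EuclideanSpace.single j 1)| ≤ 2 * c := by
    intro i j hij
    have h1 := hc i j hij.le
    have hs : (√2)⁻¹ * (√2)⁻¹ = (1 / 2 : ℝ) := by
      rw [← mul_inv, Real.mul_self_sqrt (by norm_num)]; norm_num
    have h2 : B (eDir i j) (eDir i j) =
        (1 / 2) * (B (EuclideanSpace.single i 1) (EuclideanSpace.single i 1) +
          2 * B (EuclideanSpace.single i 1) (EuclideanSpace.single j 1) +
          B (EuclideanSpace.single j 1) (EuclideanSpace.single j 1)) := by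
      simp only [eDir, hij.ne, if_false, one_div, map_smul, map_add, _root_.smul_apply,
        _root_.add_apply, smul_eq_mul]
      rw [hB (EuclideanSpace.single j 1) (EuclideanSpace.single i 1)]
      linear_combination (B (EuclideanSpace.single i 1) (EuclideanSpace.single i 1) +
          2 * B (EuclideanSpace.single i 1) (EuclideanSpace.single j 1) +
          B (EuclideanSpace.single j 1) (EuclideanSpace.single j 1)) * hs
    have h3 := hdiag i
    have h4 := hdiag j
    rw [h2] at h1
    rw [abs_le] at *
    constructor <;> linarith
  rcases lt_trichotomy i j with h | h | h
  · exact key i j h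
  · subst h
    have := hdiag i
    linarith [abs_nonneg (B (EuclideanSpace.single i 1) (EuclideanSpace.single i 1))]
  · rw [hB]; exact key j i h

theorem exists_norm_le_of_entries (a b : ℕ) : ∃ K : ℝ, 0 ≤ K ∧ ∀ (M : Matrix (Fin a) (Fin b) ℝ)
    (c : ℝ), (∀ i j, |M i j| ≤ c) → ‖M‖ ≤ K * c := by
  refine ⟨∑ i, ∑ j, ‖(Matrix.single i j (1 : ℝ) : Matrix (Fin a) (Fin b) ℝ)‖, by positivity,
    fun M c hc => ?_⟩
  conv_lhs => rw [Matrix.matrix_eq_sum_single M]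
  rw [Finset.sum_mul]
  refine (norm_sum_le _ _).trans (Finset.sum_le_sum fun i _ => ?_)
  rw [Finset.sum_mul]
  refine (norm_sum_le _ _).trans (Finset.sum_le_sum fun j _ => ?_)
  have : Matrix.single i j (M i j) = M i j • Matrix.single i j (1 : ℝ) := by simp
  rw [this, norm_smul, mul_comm]
  gcongr
  exact hc i j

/-- The variable `θ` is a parameter in which the bound is uniform. Only the modulus of the step `s r
q` is fixed, so a step may point backwards, as needed when the adjacent point is the previous
iterate. -/
theorem norm_hessian_le_of_vanishing {f : T × Param d → ℝ} {θ₀ : T} {μ₀ : Param d}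
    (hf : ContDiffAt ℝ 3 f (θ₀, μ₀)) :
    ∃ ζ : ℝ, 0 ≤ ζ ∧ ∃ ε > 0, ∀ θ ∈ Metric.ball θ₀ ε, ∀ μ ∈ Metric.ball μ₀ ε, ∀ h : ℝ, 0 < h →
      h < ε → ∀ s : Fin d → Fin d → ℝ, (∀ r q, |s r q| = h) → f (θ, μ) = 0 →
      HasFDerivAt (fun ν => f (θ, ν)) (0 : Param d →L[ℝ] ℝ) μ →
      (∀ r q, r ≤ q → f (θ, μ + s r q • eDir r q) = 0) →
      ‖hessian (fun ν => f (θ, ν)) μ‖ ≤ ζ * h := by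
  obtain ⟨L, hL, ε, hε, H⟩ := abs_fderiv_fderiv_le_of_vanishing hf
  obtain ⟨K, hK, HK⟩ := exists_norm_le_of_entries d d
  obtain ⟨ε', hε', hball⟩ := Metric.mem_nhds_iff.1 (hf.eventually (by simp))
  -- The factor `8` is the cube in `‖v‖ ≤ 2h`, `2` comes from polarization, and `K` passes from
  -- entries to the norm. Radius `ε / 3` leaves room for a step of length at most `2h < 2ε / 3`.
  refine ⟨K * (2 * (8 * L)), by positivity, min (ε / 3) ε', by positivity,
    fun θ hθ μ hμ h h0 hlt s hs f0 fd fs => ?_⟩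
  have hx : (θ, μ) ∈ Metric.ball (θ₀, μ₀) (min (ε / 3) ε') := by
    rw [← ball_prod_same]; exact ⟨hθ, hμ⟩
  have hc : ContDiffAt ℝ 3 f (θ, μ) :=
    hball (Metric.ball_subset_ball (min_le_right _ _) hx)
  have hx3 := Metric.ball_subset_ball (min_le_left _ _) hx
  have hε3 : h < ε / 3 := hlt.trans_le (min_le_left _ _)
  set B : Param d →L[ℝ] Param d →L[ℝ] ℝ :=
    (fderiv ℝ (fderiv ℝ f) (θ, μ)).bilinearComp (.inr ℝ T (Param d)) (.inr ℝ T (Param d)) with hB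
  have hsymm : ∀ x y, B x y = B y x := by
    intro x y
    have := hc.isSymmSndFDerivAt (by simp; norm_num)
    simp only [hB, ContinuousLinearMap.bilinearComp_apply]
    exact this _ _
  have hdir : ∀ r q : Fin d, r ≤ q → |B (eDir r q) (eDir r q)| ≤ 8 * L * h := by
    intro r q hrq
    set v : T × Param d := (0, s r q • eDir r q) with hv
    have hvn : ‖v‖ ≤ h * 2 := by
      rw [hv, Prod.norm_mk, norm_zero, norm_smul, Real.norm_eq_abs, hs,
        max_eq_right (by positivity)]
      gcongr
      exact norm_eDir_le r q
    have h1 := H (θ, μ) v (Metric.ball_subset_ball (by linarith) hx3) (by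
      rw [Metric.mem_ball, dist_eq_norm] at hx3 ⊢
      calc ‖(θ, μ) + v - (θ₀, μ₀)‖ = ‖((θ, μ) - (θ₀, μ₀)) + v‖ := by congr 1; abel
        _ ≤ _ := norm_add_le _ _
        _ < ε := by linarith) f0 (by simpa [hv] using fs r q hrq) (by
      have h3 := (hasFDerivAt_slice (hc.differentiableAt (by simp))).unique fd
      exact congrArg (fun A => A (s r q • eDir r q)) h3)
    have h2 : fderiv ℝ (fderiv ℝ f) (θ, μ) v v = h ^ 2 * B (eDir r q) (eDir r q) := by
      have : v = s r q • ContinuousLinearMap.inr ℝ T (Param d) (eDir r q) := by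
        ext1 <;> simp [hv]
      rw [this]
      simp only [map_smul, _root_.smul_apply, smul_eq_mul, hB,
        ContinuousLinearMap.bilinearComp_apply]
      rw [← mul_assoc, ← hs r q, sq_abs, sq]
    rw [h2, abs_mul, abs_of_pos (by positivity)] at h1
    have h3 : h ^ 2 * |B (eDir r q) (eDir r q)| ≤ h ^ 2 * (8 * L * h) :=
      h1.trans (by
        calc L * ‖v‖ ^ 3 ≤ L * (h * 2) ^ 3 := by gcongr
          _ = _ := by ring)
    exact le_of_mul_le_mul_left h3 (by positivity)
  have := HK (hessian (fun ν => f (θ, ν)) μ) (2 * (8 * L * h)) fun i j => by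
    rw [hessian_slice (hc.of_le (by norm_num))]
    exact abs_le_of_eDir hsymm hdir i j
  calc _ ≤ _ := this
    _ = _ := by ring

end Hessian

end HinfMin

namespace HinfMin

/-! ### Singular values, the spectral norm and characteristic polynomials -/

section SingularValues

open Module InnerProductSpace

/-- Expansion in an eigenbasis of `T* T`; both the norm formula and the lower bound by the smallest
singular value are read off from it. -/
theorem norm_sq_eq_sum_singularValues {E F : Type*} [NormedAddCommGroup E] [InnerProductSpace ℂ E]
    [FiniteDimensional ℂ E] [NormedAddCommGroup F] [InnerProductSpace ℂ F] [FiniteDimensional ℂ F]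
    (T : E →ₗ[ℂ] F) : ∃ b : OrthonormalBasis (Fin (finrank ℂ E)) ℂ E,
      ∀ x, ‖T x‖ ^ 2 = ∑ i : Fin (finrank ℂ E), T.singularValues i ^ 2 * ‖b.repr x i‖ ^ 2 := by
  refine ⟨T.isSymmetric_adjoint_comp_self.eigenvectorBasis rfl, fun x => ?_⟩
  set b := T.isSymmetric_adjoint_comp_self.eigenvectorBasis rfl with hb
  have h1 : (‖T x‖ : ℂ) ^ 2 = ⟪(LinearMap.adjoint T ∘ₗ T) x, x⟫_ℂ := by
    rw [LinearMap.comp_apply, LinearMap.adjoint_inner_left, inner_self_eq_norm_sq_to_K]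
    rfl
  rw [← b.repr.inner_map_map, PiLp.inner_apply] at h1
  have h2 : ∀ i, ⟪b.repr ((LinearMap.adjoint T ∘ₗ T) x) i, b.repr x i⟫_ℂ =
      ((T.singularValues i ^ 2 * ‖b.repr x i‖ ^ 2 : ℝ) : ℂ) := by
    intro i
    rw [hb, LinearMap.IsSymmetric.eigenvectorBasis_apply_self_apply,
      ← T.sq_singularValues_fin rfl, ← hb, RCLike.inner_apply, map_mul, mul_comm, mul_assoc,
      RCLike.conj_mul]
    simp
  rw [Finset.sum_congr rfl fun i _ => h2 i, ← Complex.ofReal_sum, ← Complex.ofReal_pow] at h1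
  exact Complex.ofReal_injective h1

variable {a b : ℕ}

theorem sigmaMax_eq_norm (M : Matrix (Fin a) (Fin b) ℂ) : sigmaMax M = ‖M‖ := by
  set T := Matrix.toEuclideanLin M with hT
  have hn : ‖M‖ = ‖LinearMap.toContinuousLinearMap T‖ := rfl
  rw [hn]
  unfold sigmaMax
  rw [← hT]
  obtain ⟨B, hB⟩ := norm_sq_eq_sum_singularValues T
  have h0 := T.singularValues_nonneg 0
  apply le_antisymm
  · rcases Nat.eq_zero_or_pos (finrank ℂ (EuclideanSpace ℂ (Fin b))) with h | h
    · rw [T.singularValues_of_finrank_le (by omega)]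
      exact norm_nonneg _
    · have h1 := (LinearMap.toContinuousLinearMap T).le_opNorm (B ⟨0, h⟩)
      have h2 := hB (B ⟨0, h⟩)
      rw [OrthonormalBasis.repr_self] at h2
      simp only [PiLp.single_apply] at h2
      rw [Finset.sum_eq_single ⟨0, h⟩ (by intro i _ hi; simp [hi]) (by simp)] at h2
      simp only [if_true, norm_one, one_pow, mul_one] at h2
      rw [(B.orthonormal.1 _), mul_one] at h1
      have h3 : ‖T (B ⟨0, h⟩)‖ = T.singularValues 0 :=
        (sq_eq_sq₀ (norm_nonneg _) h0).1 h2
      rw [← h3]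
      exact h1
  · refine ContinuousLinearMap.opNorm_le_bound _ h0 fun x => ?_
    rw [← sq_le_sq₀ (norm_nonneg _) (by positivity), mul_pow]
    calc _ = _ := hB x
      _ ≤ ∑ i : Fin _, T.singularValues 0 ^ 2 * ‖B.repr x i‖ ^ 2 := by
        gcongr with i
        · exact T.singularValues_nonneg _
        · exact T.singularValues_antitone (Nat.zero_le _)
      _ = _ := by rw [← Finset.mul_sum, ← EuclideanSpace.norm_sq_eq, B.repr.norm_map]

theorem sigmaMin_mul_norm_le (M : Matrix (Fin a) (Fin a) ℂ) (x : EuclideanSpace ℂ (Fin a)) :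
    sigmaMin M * ‖x‖ ≤ ‖Matrix.toEuclideanLin M x‖ := by
  unfold sigmaMin
  set T := Matrix.toEuclideanLin M with hT
  obtain ⟨B, hB⟩ := norm_sq_eq_sum_singularValues T
  have h0 := T.singularValues_nonneg (a - 1)
  rw [← sq_le_sq₀ (by positivity) (norm_nonneg _), mul_pow, hB x, ← B.repr.norm_map,
    EuclideanSpace.norm_sq_eq, Finset.mul_sum]
  gcongr with i
  refine T.singularValues_antitone ?_
  have := i.2.trans_eq finrank_euclideanSpace_fin
  omega

theorem det_ne_zero_of_forall_mul_norm_le {M : Matrix (Fin a) (Fin a) ℂ} {β : ℝ} (hβ : 0 < β)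
    (h : ∀ x : EuclideanSpace ℂ (Fin a), β * ‖x‖ ≤ ‖Matrix.toEuclideanLin M x‖) : M.det ≠ 0 := by
  intro hdet
  obtain ⟨v, hv, hMv⟩ := Matrix.exists_mulVec_eq_zero_iff.2 hdet
  have := h (WithLp.toLp 2 v)
  have h2 : Matrix.toEuclideanLin M (WithLp.toLp 2 v) = 0 := by
    change WithLp.toLp 2 (M *ᵥ v) = 0
    rw [hMv]; rfl
  rw [h2, norm_zero] at this
  have h3 : 0 < ‖WithLp.toLp 2 v‖ := norm_pos_iff.2 (by simpa using hv)
  nlinarith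

/-- The squared singular values are the eigenvalues of `Mᴴ M`. The point is that the left side is
manifestly smooth in `M` and `x`, while the right side shows its roots. -/
theorem det_smul_one_sub_conjTranspose_mul_self (M : Matrix (Fin a) (Fin b) ℂ) (x : ℝ) :
    ((x : ℂ) • (1 : Matrix (Fin b) (Fin b) ℂ) - Mᴴ * M).det =
      ((∏ i : Fin b, (x - (Matrix.toEuclideanLin M).singularValues i ^ 2) : ℝ) : ℂ) := by
  set T := Matrix.toEuclideanLin M with hT
  have h1 : LinearMap.adjoint T ∘ₗ T = Matrix.toEuclideanLin (Mᴴ * M) := by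
    rw [hT, ← Matrix.toEuclideanLin_conjTranspose_eq_adjoint]
    ext x
    simp [Matrix.toLpLin_apply, Matrix.mulVec_mulVec]
  have h2 : (LinearMap.adjoint T ∘ₗ T).charpoly = (Mᴴ * M).charpoly := by
    rw [h1, Matrix.toEuclideanLin_eq_toLin_orthonormal,
      ← LinearMap.charpoly_toMatrix _ (EuclideanSpace.basisFun (Fin b) ℂ).toBasis,
      LinearMap.toMatrix_toLin]
  have h3 := T.isSymmetric_adjoint_comp_self.charpoly_eq (finrank_euclideanSpace_fin (n := b))
  rw [h2] at h3
  have h4 := congrArg (Polynomial.eval (x : ℂ)) h3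
  rw [Matrix.eval_charpoly, Polynomial.eval_prod] at h4
  rw [Matrix.smul_one_eq_diagonal]
  rw [Matrix.scalar_apply] at h4
  rw [h4]
  push_cast
  refine Finset.prod_congr rfl fun i _ => ?_
  rw [Polynomial.eval_sub, Polynomial.eval_X, Polynomial.eval_C,
    ← T.sq_singularValues_fin (finrank_euclideanSpace_fin (n := b))]
  simp

end SingularValues

/-! ### Smoothness of matrix operations and of the norm at a simple singular value -/

section MatrixSmoothness

variable {X : Type*} [NormedAddCommGroup X] [NormedSpace ℝ X] {a b c : ℕ} {k : WithTop ℕ∞}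

theorem contDiffAt_matrix_iff {M : X → Matrix (Fin a) (Fin b) ℂ} {x : X} :
    ContDiffAt ℝ k M x ↔ ∀ i j, ContDiffAt ℝ k (fun y => M y i j) x := by
  let L : Matrix (Fin a) (Fin b) ℂ ≃L[ℝ] (Fin a → Fin b → ℂ) :=
    (LinearEquiv.refl ℝ (Matrix (Fin a) (Fin b) ℂ)).toContinuousLinearEquiv
  rw [← L.comp_contDiffAt_iff, contDiffAt_pi]
  refine forall_congr' fun i => ?_
  rw [contDiffAt_pi]
  rfl

theorem ContDiffAt.matrix_mul {M : X → Matrix (Fin a) (Fin b) ℂ} {N : X → Matrix (Fin b) (Fin c) ℂ}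
    {x : X} (hM : ContDiffAt ℝ k M x) (hN : ContDiffAt ℝ k N x) :
    ContDiffAt ℝ k (fun y => M y * N y) x := by
  rw [contDiffAt_matrix_iff] at *
  intro i j
  simp only [Matrix.mul_apply]
  exact ContDiffAt.sum fun l _ => (hM i l).mul (hN l j)

theorem ContDiffAt.matrix_conjTranspose {M : X → Matrix (Fin a) (Fin b) ℂ} {x : X}
    (hM : ContDiffAt ℝ k M x) : ContDiffAt ℝ k (fun y => (M y)ᴴ) x := by
  rw [contDiffAt_matrix_iff] at *
  intro i j
  exact Complex.conjCLE.contDiff.contDiffAt.comp x (hM j i)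

theorem ContDiffAt.matrix_det {M : X → Matrix (Fin a) (Fin a) ℂ} {x : X}
    (hM : ContDiffAt ℝ k M x) : ContDiffAt ℝ k (fun y => (M y).det) x := by
  rw [contDiffAt_matrix_iff] at hM
  simp only [Matrix.det_apply]
  refine ContDiffAt.sum fun σ _ => ContDiffAt.const_smul _ ?_
  exact contDiffAt_prod fun i _ => hM _ _

theorem ContDiffAt.matrix_inv {M : X → Matrix (Fin a) (Fin a) ℂ} {x : X}
    (hM : ContDiffAt ℝ k M x) (h : (M x).det ≠ 0) : ContDiffAt ℝ k (fun y => (M y)⁻¹) x := by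
  have hd := ContDiffAt.matrix_det hM
  simp only [Matrix.inv_def, Ring.inverse_eq_inv']
  refine (hd.inv h).smul ?_
  rw [contDiffAt_matrix_iff]
  intro i j
  simp only [Matrix.adjugate_apply]
  refine ContDiffAt.matrix_det ?_
  rw [contDiffAt_matrix_iff] at *
  intro i' j'
  by_cases h' : i' = j
  · subst h'
    simp only [Matrix.updateRow_self]
    exact contDiffAt_const
  · simp only [Matrix.updateRow_ne h']
    exact hM i' j'

/-- `‖M‖²` is a root in `t` of `det (t - Mᴴ M)`, and at `M₀` it is a simple one. The implicit
function theorem makes the root near `‖M₀‖²` smooth in `M`; by continuity of the norm that root is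
`‖M‖²`, and positivity allows the square root. -/
theorem contDiffAt_norm_of_simple {M₀ : Matrix (Fin a) (Fin b) ℂ} (hpos : 0 < ‖M₀‖)
    (hsimple : sigmaSecond M₀ < ‖M₀‖) :
    ContDiffAt ℝ 4 (fun M : Matrix (Fin a) (Fin b) ℂ => ‖M‖) M₀ := by
  have hb : 0 < b := by
    rcases Nat.eq_zero_or_pos b with rfl | h
    · exfalso
      have : M₀ = 0 := by ext i j; exact j.elim0
      simp [this] at hpos
    · exact h
  set F : Matrix (Fin a) (Fin b) ℂ × ℝ → ℝ := fun y =>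
    (((y.2 : ℂ) • (1 : Matrix (Fin b) (Fin b) ℂ) - y.1ᴴ * y.1).det).re with hF
  have hFprod : ∀ y, F y = ∏ i : Fin b,
      (y.2 - (Matrix.toEuclideanLin y.1).singularValues i ^ 2) := by
    intro y
    simp only [hF]
    rw [det_smul_one_sub_conjTranspose_mul_self, Complex.ofReal_re]
  have hF0 : ∀ M, F (M, ‖M‖ ^ 2) = 0 := by
    intro M
    rw [hFprod]
    refine Finset.prod_eq_zero (Finset.mem_univ ⟨0, hb⟩) ?_
    rw [← sigmaMax_eq_norm]
    simp [sigmaMax]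
  have hFc : ContDiffAt ℝ 4 F (M₀, ‖M₀‖ ^ 2) := by
    refine Complex.reCLM.contDiff.contDiffAt.comp _ ?_
    refine ContDiffAt.matrix_det ?_
    refine ContDiffAt.sub ?_ ?_
    · exact (Complex.ofRealCLM.contDiff.contDiffAt.comp _ contDiffAt_snd).smul contDiffAt_const
    · exact ContDiffAt.matrix_mul (ContDiffAt.matrix_conjTranspose contDiffAt_fst) contDiffAt_fst
  -- `P` is the `t`-derivative of `F` at the root: the product of the remaining factors. Simplicity
  -- of the largest singular value makes each of them positive; for `b = 1` the product is empty.
  set P : ℝ := ∏ i ∈ Finset.univ.erase (⟨0, hb⟩ : Fin b),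
    (‖M₀‖ ^ 2 - (Matrix.toEuclideanLin M₀).singularValues i ^ 2) with hP
  have hPpos : 0 < P := by
    refine Finset.prod_pos fun i hi => ?_
    have h1 : 1 ≤ (i : ℕ) := by
      have := Finset.ne_of_mem_erase hi
      rw [ne_eq, Fin.ext_iff] at this
      change ¬ (i : ℕ) = 0 at this
      omega
    have h2 := (Matrix.toEuclideanLin M₀).singularValues_antitone h1
    have h3 := (Matrix.toEuclideanLin M₀).singularValues_nonneg i
    have h4 : (Matrix.toEuclideanLin M₀).singularValues 1 < ‖M₀‖ := hsimple
    nlinarith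
  have hder : HasDerivAt (fun t => F (M₀, t)) P (‖M₀‖ ^ 2) := by
    have e : (fun t => F (M₀, t)) = fun t => (t - ‖M₀‖ ^ 2) *
        ∏ i ∈ Finset.univ.erase (⟨0, hb⟩ : Fin b),
          (t - (Matrix.toEuclideanLin M₀).singularValues i ^ 2) := by
      funext t
      rw [hFprod, ← Finset.mul_prod_erase _ _ (Finset.mem_univ (⟨0, hb⟩ : Fin b)),
        ← sigmaMax_eq_norm]
      rfl
    rw [e]
    have hd : DifferentiableAt ℝ (fun t : ℝ => ∏ i ∈ Finset.univ.erase (⟨0, hb⟩ : Fin b),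
          (t - (Matrix.toEuclideanLin M₀).singularValues i ^ 2)) (‖M₀‖ ^ 2) := by
      fun_prop
    have := ((hasDerivAt_id' (‖M₀‖ ^ 2)).sub_const (‖M₀‖ ^ 2)).mul hd.hasDerivAt
    convert! this using 1
    simp [hP]
  have hinr : fderiv ℝ F (M₀, ‖M₀‖ ^ 2) (0, 1) = P :=
    HasDerivAt.unique (HasFDerivAt.comp_hasDerivAt (l := F) (f := fun t : ℝ => (M₀, t)) (‖M₀‖ ^ 2)
      (hFc.differentiableAt (by simp)).hasFDerivAt
      ((hasDerivAt_const _ _).prodMk (hasDerivAt_id _))) hder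
  have hinv : (fderiv ℝ F (M₀, ‖M₀‖ ^ 2) ∘L .inr ℝ _ ℝ).IsInvertible := by
    refine ⟨ContinuousLinearEquiv.unitsEquivAut ℝ (Units.mk0 P hPpos.ne'), ?_⟩
    ext
    simp [hinr]
  have hev := hFc.eventually_apply_eq_iff_implicitFunction (by simp) hinv
  have hgc := hFc.contDiffAt_implicitFunction (by simp) hinv
  set g := hFc.implicitFunction (by simp) hinv with hg
  have hlim : Tendsto (fun M : Matrix (Fin a) (Fin b) ℂ => (M, ‖M‖ ^ 2)) (𝓝 M₀)
      (𝓝 (M₀, ‖M₀‖ ^ 2)) := by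
    have : Continuous (fun M : Matrix (Fin a) (Fin b) ℂ => (M, ‖M‖ ^ 2)) := by fun_prop
    exact this.tendsto M₀
  have heq : (fun M : Matrix (Fin a) (Fin b) ℂ => ‖M‖) =ᶠ[𝓝 M₀] fun M => √(g M) := by
    filter_upwards [hlim.eventually hev] with M hM
    rw [hM.1 (by rw [hF0, hF0]), Real.sqrt_sq (norm_nonneg _)]
  refine ContDiffAt.congr_of_eventuallyEq (hgc.sqrt ?_) heq
  have : g M₀ = ‖M₀‖ ^ 2 := hFc.implicitFunction_apply_self (by simp) hinv
  simp only [hg] at this ⊢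
  rw [this]
  positivity

end MatrixSmoothness

end HinfMin

/-! ### Transfer functions as rational functions, and the H-infinity norm on the imaginary axis -/

namespace HinfMin

theorem ratFunc_eval_div {K : Type*} [Field K] {p q : Polynomial K} {s : K} (h : q.eval s ≠ 0) :
    RatFunc.eval (RingHom.id K) s (algebraMap _ (RatFunc K) p / algebraMap _ (RatFunc K) q) =
      p.eval s / q.eval s := by
  have hq : q ≠ 0 := by rintro rfl; simp at h
  have h1 := RatFunc.num_mul_eq_mul_denom_iff (x := algebraMap _ (RatFunc K) p / algebraMap _ (RatFunc K) q)
    (p := p) hq |>.2 rfl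
  have h2 : (RatFunc.denom (algebraMap _ (RatFunc K) p / algebraMap _ (RatFunc K) q)).eval s ≠ 0 := by
    obtain ⟨c, hc⟩ := RatFunc.denom_div_dvd p q
    rw [hc, Polynomial.eval_mul] at h
    exact left_ne_zero_of_mul h
  rw [RatFunc.eval, Polynomial.eval₂_id, Polynomial.eval₂_id, div_eq_div_iff h2 h]
  have h3 := congrArg (Polynomial.eval s) h1
  simpa using h3

theorem ratFunc_eval_div_denom (q : RatFunc ℂ) (s : ℂ) :
    RatFunc.eval (RingHom.id ℂ) s q = q.num.eval s / q.denom.eval s := by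
  rw [RatFunc.eval, Polynomial.eval₂_id, Polynomial.eval₂_id]

/-- At a zero of the denominator `RatFunc.eval` gives `0`, so the bound at `s` itself excludes
nothing. Instead `s` is approached along `s + t` with `t` decreasing to `0`, avoiding the finitely
many zeros: the bounded quotient forces the numerator to vanish at `s` too, against coprimality. -/
theorem ratFunc_denom_eval_ne_zero {q : RatFunc ℂ} {K : ℝ}
    (hK : ∀ s : ℂ, 0 < s.re → ‖RatFunc.eval (RingHom.id ℂ) s q‖ ≤ K) {s : ℂ} (hs : 0 ≤ s.re) :
    q.denom.eval s ≠ 0 := by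
  intro h0
  have hn : q.num.eval s ≠ 0 := by
    intro hn
    obtain ⟨a, b, hab⟩ := RatFunc.isCoprime_num_denom q
    have := congrArg (Polynomial.eval s) hab
    simp [h0, hn] at this
  have hcont : Continuous (fun t : ℝ => s + (t : ℂ)) := by fun_prop
  have hfin : {t : ℝ | q.denom.eval (s + (t : ℂ)) = 0}.Finite := by
    have h1 : {z : ℂ | q.denom.eval z = 0}.Finite :=
      Polynomial.finite_setOfPred_isRoot (RatFunc.denom_ne_zero q)
    exact h1.preimage (f := fun t : ℝ => s + (t : ℂ)) fun x _ y _ hxy => by simpa using hxy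
  have hev : ∀ᶠ t : ℝ in 𝓝[>] 0, q.denom.eval (s + (t : ℂ)) ≠ 0 := by
    have h2 : ({t : ℝ | q.denom.eval (s + (t : ℂ)) = 0} \ {0})ᶜ ∈ 𝓝 (0 : ℝ) :=
      (hfin.subset sdiff_subset).isClosed.isOpen_compl.mem_nhds (by simp)
    filter_upwards [mem_nhdsWithin_of_mem_nhds h2, self_mem_nhdsWithin] with t ht ht0 hz
    exact ht ⟨hz, fun h => ne_of_gt (mem_Ioi.1 ht0) h⟩
  have hle : ∀ᶠ t : ℝ in 𝓝[>] 0, ‖q.num.eval (s + (t : ℂ))‖ ≤ K * ‖q.denom.eval (s + (t : ℂ))‖ := by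
    filter_upwards [hev, self_mem_nhdsWithin] with t ht ht0
    have := hK (s + t) (by simpa using add_pos_of_nonneg_of_pos hs ht0)
    rwa [ratFunc_eval_div_denom, norm_div, div_le_iff₀ (norm_pos_iff.2 ht)] at this
  have l1 : Tendsto (fun t : ℝ => ‖q.num.eval (s + (t : ℂ))‖) (𝓝[>] 0) (𝓝 ‖q.num.eval s‖) := by
    have : Continuous (fun t : ℝ => ‖q.num.eval (s + (t : ℂ))‖) := by fun_prop
    exact (this.tendsto' 0 _ (by simp)).mono_left nhdsWithin_le_nhds
  have l2 : Tendsto (fun t : ℝ => K * ‖q.denom.eval (s + (t : ℂ))‖) (𝓝[>] 0) (𝓝 0) := by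
    have : Continuous (fun t : ℝ => K * ‖q.denom.eval (s + (t : ℂ))‖) := by fun_prop
    exact (this.tendsto' 0 _ (by simp [h0])).mono_left nhdsWithin_le_nhds
  have := le_of_tendsto_of_tendsto l1 l2 hle
  exact hn (norm_le_zero_iff.1 this)

theorem norm_entry_le {a b : ℕ} (M : Matrix (Fin a) (Fin b) ℂ) (i : Fin a) (j : Fin b) :
    ‖M i j‖ ≤ ‖M‖ := by
  have h := M.l2_opNorm_mulVec (EuclideanSpace.single j 1)
  have h2 := PiLp.norm_apply_le ((EuclideanSpace.equiv (Fin a) ℂ).symm (M *ᵥ (EuclideanSpace.single j (1 : ℂ)))) i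
  have h3 : ((EuclideanSpace.equiv (Fin a) ℂ).symm (M *ᵥ (EuclideanSpace.single j (1 : ℂ)))) i = M i j := by
    simp
  rw [h3] at h2
  simpa using h2.trans h

theorem differentiableAt_matrix {a b : ℕ} {M : ℂ → Matrix (Fin a) (Fin b) ℂ} {s : ℂ}
    (h : ∀ i j, DifferentiableAt ℂ (fun z => M z i j) s) : DifferentiableAt ℂ M s := by
  let L : Matrix (Fin a) (Fin b) ℂ ≃L[ℂ] (Fin a → Fin b → ℂ) :=
    (LinearEquiv.refl ℂ (Matrix (Fin a) (Fin b) ℂ)).toContinuousLinearEquiv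
  rw [← L.comp_differentiableAt_iff]
  exact differentiableAt_pi.2 fun i => differentiableAt_pi.2 fun j => h i j

namespace Descriptor

variable {r m p : ℕ} (P : Descriptor r m p)

theorem sigma_eq_norm (ω : ℝ) : P.sigma ω = ‖P.H (Complex.I * ω)‖ := sigmaMax_eq_norm _

/-- By Cramer's rule each entry is a polynomial over `det (s E - A)`. Cancelling common factors does
not change its value where that determinant is nonzero. -/
theorem H_eq {s : ℂ} (h : (P.D s).det ≠ 0) : P.H s = P.C * (P.D s)⁻¹ * P.B := by
  set N : Matrix (Fin r) (Fin r) (Polynomial ℂ) :=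
    (Polynomial.X : Polynomial ℂ) • P.E.map Polynomial.C - P.A.map Polynomial.C with hN
  set φ := algebraMap (Polynomial ℂ) (RatFunc ℂ) with hφ
  have hM : (RatFunc.X : RatFunc ℂ) • P.E.map RatFunc.C - P.A.map RatFunc.C = φ.mapMatrix N := by
    ext i j
    simp [hN, hφ]
    exact mul_comm _ _
  have hD : (Polynomial.evalRingHom s).mapMatrix N = P.D s := by
    ext i j
    simp [hN, Descriptor.D]
    exact mul_comm _ _
  have hdet : N.det.eval s = (P.D s).det := by
    rw [← hD, ← RingHom.map_det]; rfl
  have hadj : N.adjugate.map (Polynomial.eval s) = (P.D s).adjugate := by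
    rw [← hD, ← RingHom.map_adjugate]; rfl
  set Q : Matrix (Fin p) (Fin m) (Polynomial ℂ) :=
    P.C.map Polynomial.C * N.adjugate * P.B.map Polynomial.C with hQ
  have hQs : Q.map (Polynomial.evalRingHom s) = P.C * (P.D s).adjugate * P.B := by
    rw [hQ, Matrix.map_mul, Matrix.map_mul, Matrix.map_map, Matrix.map_map, ← hadj]
    congr 2
    · ext i j; simp
    · ext i j; simp
  have ht : P.transfer = (φ N.det)⁻¹ • Q.map φ := by
    unfold transfer
    rw [hM, Matrix.inv_def, ← RingHom.map_det, ← RingHom.map_adjugate, Ring.inverse_eq_inv', hQ,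
      Matrix.map_mul, Matrix.map_mul, Matrix.map_map, Matrix.map_map, Matrix.mul_smul,
      Matrix.smul_mul]
    rfl
  ext i j
  have h1 : P.H s i j = (Q i j).eval s / N.det.eval s := by
    rw [← ratFunc_eval_div (by rw [hdet]; exact h)]
    simp only [H, Matrix.map_apply, ht, Matrix.smul_apply, smul_eq_mul]
    rw [div_eq_inv_mul]
  rw [h1, hdet, Matrix.inv_def, Matrix.mul_smul, Matrix.smul_mul, ← hQs, Ring.inverse_eq_inv',
    Matrix.smul_apply, smul_eq_mul, div_eq_inv_mul]
  rfl

variable {P}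

theorem IsHinf.differentiableAt (hP : P.IsHinf) {s : ℂ} (hs : 0 ≤ s.re) :
    DifferentiableAt ℂ P.H s := by
  obtain ⟨K, hK⟩ := hP.2
  refine differentiableAt_matrix fun i j => ?_
  have hden : (P.transfer i j).denom.eval s ≠ 0 := by
    refine ratFunc_denom_eval_ne_zero (K := K) (fun z hz => ?_) hs
    exact (norm_entry_le (P.H z) i j).trans (hK ⟨⟨z, hz⟩, rfl⟩)
  simp only [H, Matrix.map_apply, ratFunc_eval_div_denom]
  exact (Polynomial.differentiableAt _).div (Polynomial.differentiableAt _) hden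

/-- The Phragmén–Lindelöf principle bounds the values in the half plane by those on the imaginary
axis; conversely, a value on the axis is a limit from the right. -/
theorem IsHinf.hinfNorm_eq (hP : P.IsHinf) {ω₀ : ℝ} (hmax : ∀ ω : ℝ, P.sigma ω ≤ P.sigma ω₀) :
    P.hinfNorm = P.sigma ω₀ := by
  have hbdd := hP.2
  obtain ⟨K, hK⟩ := hP.2
  apply le_antisymm
  · have : Nonempty {s : ℂ // 0 < s.re} := ⟨⟨1, by simp⟩⟩
    refine ciSup_le fun s => ?_
    -- Growth exponent and factor are both `0`, since the function is bounded.
    refine PhragmenLindelof.right_half_plane_of_bounded_on_real (f := P.H) ?_ ⟨0, by norm_num, 0, ?_⟩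
      ?_ ?_ s.2.le
    · refine DifferentiableOn.diffContOnCl fun z hz => ?_
      rw [Complex.closure_setOfPred_lt_re] at hz
      exact (hP.differentiableAt hz).differentiableWithinAt
    · refine Asymptotics.IsBigO.of_bound K ?_
      refine (eventually_principal.2 fun z hz => ?_).filter_mono inf_le_right
      simpa using hK ⟨⟨z, hz⟩, rfl⟩
    · refine ⟨K, ?_⟩
      rw [eventually_map]
      filter_upwards [eventually_gt_atTop 0] with x hx
      exact hK ⟨⟨(x : ℂ), by simpa using hx⟩, rfl⟩
    · intro x
      rw [mul_comm, ← sigma_eq_norm]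
      exact hmax x
  · rw [sigma_eq_norm]
    have hc : ContinuousAt (fun t : ℝ => ‖P.H (Complex.I * ω₀ + t)‖) 0 := by
      refine ContinuousAt.norm ?_
      refine ContinuousAt.comp (g := P.H) (f := fun t : ℝ => Complex.I * ω₀ + (t : ℂ)) ?_
        (by fun_prop)
      simp only [Complex.ofReal_zero, add_zero]
      exact (hP.differentiableAt (by simp)).continuousAt
    have hl : Tendsto (fun t : ℝ => ‖P.H (Complex.I * ω₀ + t)‖) (𝓝[>] 0)
        (𝓝 ‖P.H (Complex.I * ω₀)‖) := by
      have := hc.tendsto.mono_left (nhdsWithin_le_nhds (s := Ioi 0))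
      simpa using this
    refine le_of_tendsto hl ?_
    filter_upwards [self_mem_nhdsWithin] with t ht
    exact le_ciSup hbdd ⟨Complex.I * ω₀ + t, by simpa using ht⟩

end Descriptor

end HinfMin

namespace HinfMin

/-! ### Hermite interpolation of the largest singular value by projection -/

section Interpolation

variable {X : Type*} [NormedAddCommGroup X] [NormedSpace ℝ X] {a b c n r m p : ℕ}

theorem isLittleO_norm_mul {A : X → Matrix (Fin a) (Fin b) ℂ} {R : X → Matrix (Fin b) (Fin c) ℂ}
    {x₀ : X} (hA : ContDiffAt ℝ 1 A x₀) (hR : ContDiffAt ℝ 1 R x₀) (hA0 : A x₀ = 0)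
    (hR0 : R x₀ = 0) : (fun x => ‖A x * R x‖) =o[𝓝 x₀] fun x => x - x₀ := by
  have h1 := (hA.differentiableAt (by simp)).isBigO_sub
  have h2 : R =o[𝓝 x₀] fun _ => (1 : ℝ) := by
    rw [Asymptotics.isLittleO_one_iff, ← hR0]
    exact hR.continuousAt
  simp only [hA0, sub_zero] at h1
  have h3 : (fun x => ‖A x‖ * ‖R x‖) =o[𝓝 x₀] fun x => ‖x - x₀‖ * 1 :=
    h1.norm_norm.mul_isLittleO h2.norm_left
  simp only [mul_one] at h3
  refine Asymptotics.IsBigO.trans_isLittleO ?_ h3.of_norm_right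
  refine Asymptotics.IsBigO.of_bound 1 (Eventually.of_forall fun x => ?_)
  rw [norm_norm, one_mul, norm_mul, norm_norm, norm_norm]
  exact Matrix.l2_opNorm_mul _ _

theorem differentiableAt_norm_comp {M : X → Matrix (Fin a) (Fin b) ℂ} {x₀ : X}
    (hM : ContDiffAt ℝ 1 M x₀)
    (hn : DifferentiableAt ℝ (fun N : Matrix (Fin a) (Fin b) ℂ => ‖N‖) (M x₀)) :
    DifferentiableAt ℝ (fun x => ‖M x‖) x₀ :=
  DifferentiableAt.comp (g := fun N : Matrix (Fin a) (Fin b) ℂ => ‖N‖) x₀ hn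
    (hM.differentiableAt (by simp))

/-- With `E = M - N`, `NᴴN - MᴴM = -MᴴE - EᴴM + EᴴE`. Since `E` vanishes at `x₀`, replacing `M` by
`M x₀` costs only second order. So it suffices that the derivative of `E` is annihilated by `(M
x₀)ᴴ`; the derivative of the transfer function itself need not match. This is what makes one-sided
directions multiplied by `H` enough when `m ≠ p`. -/
theorem fderiv_norm_eq_of_isLittleO {M N : X → Matrix (Fin a) (Fin b) ℂ} {x₀ : X}
    (hM : ContDiffAt ℝ 1 M x₀) (hN : ContDiffAt ℝ 1 N x₀) (h0 : N x₀ = M x₀)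
    (hn : DifferentiableAt ℝ (fun N : Matrix (Fin a) (Fin b) ℂ => ‖N‖) (M x₀)) (hpos : 0 < ‖M x₀‖)
    (hE : (fun x => ‖(M x₀)ᴴ * (M x - N x)‖) =o[𝓝 x₀] fun x => x - x₀) :
    fderiv ℝ (fun x => ‖N x‖) x₀ = fderiv ℝ (fun x => ‖M x‖) x₀ := by
  have dM := differentiableAt_norm_comp hM hn
  have dN := differentiableAt_norm_comp hN (by rwa [h0])
  have cE : ContDiffAt ℝ 1 (fun x => M x - N x) x₀ := hM.sub hN
  have e1 := isLittleO_norm_mul (ContDiffAt.matrix_conjTranspose (hM.sub contDiffAt_const)) cE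
    (by simp : (M x₀ - M x₀)ᴴ = 0) (by simp [h0])
  have e2 := isLittleO_norm_mul (ContDiffAt.matrix_conjTranspose cE) cE
    (by simp [h0]) (by simp [h0])
  have key : ∀ x, |‖N x‖ ^ 2 - ‖M x‖ ^ 2| ≤ 2 * ‖(M x₀)ᴴ * (M x - N x)‖ +
      2 * ‖(M x - M x₀)ᴴ * (M x - N x)‖ + ‖(M x - N x)ᴴ * (M x - N x)‖ := by
    intro x
    rw [sq, sq, ← Matrix.l2_opNorm_conjTranspose_mul_self, ← Matrix.l2_opNorm_conjTranspose_mul_self]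
    refine (abs_norm_sub_norm_le _ _).trans ?_
    have h1 : (N x)ᴴ * N x - (M x)ᴴ * M x =
        -((M x₀)ᴴ * (M x - N x)) - ((M x - M x₀)ᴴ * (M x - N x)) -
        ((M x₀)ᴴ * (M x - N x))ᴴ - ((M x - M x₀)ᴴ * (M x - N x))ᴴ +
        (M x - N x)ᴴ * (M x - N x) := by
      simp only [Matrix.conjTranspose_mul, Matrix.conjTranspose_sub,
        Matrix.conjTranspose_conjTranspose, Matrix.mul_sub, Matrix.sub_mul]
      abel
    rw [h1]
    refine (norm_add_le _ _).trans (add_le_add ?_ le_rfl)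
    refine (norm_sub_le _ _).trans ?_
    have h2 := norm_sub_le (-((M x₀)ᴴ * (M x - N x)) - ((M x - M x₀)ᴴ * (M x - N x)))
      ((M x₀)ᴴ * (M x - N x))ᴴ
    have h3 := norm_sub_le (-((M x₀)ᴴ * (M x - N x))) ((M x - M x₀)ᴴ * (M x - N x))
    rw [norm_neg] at h3
    rw [Matrix.l2_opNorm_conjTranspose] at h2 ⊢
    linarith
  have hlo : (fun x => ‖N x‖ ^ 2 - ‖M x‖ ^ 2) =o[𝓝 x₀] fun x => x - x₀ := by
    refine Asymptotics.IsBigO.trans_isLittleO ?_ (((hE.const_mul_left 2).add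
      (e1.const_mul_left 2)).add e2)
    refine Asymptotics.IsBigO.of_bound 1 (Eventually.of_forall fun x => ?_)
    rw [one_mul, Real.norm_eq_abs]
    exact (key x).trans (le_abs_self _)
  have hder : HasFDerivAt (fun x => ‖N x‖ ^ 2 - ‖M x‖ ^ 2) (0 : X →L[ℝ] ℝ) x₀ := by
    rw [hasFDerivAt_iff_isLittleO]
    simpa [h0] using hlo
  have h2 := hder.unique ((dN.hasFDerivAt.pow 2).sub (dM.hasFDerivAt.pow 2))
  rw [h0] at h2
  ext v
  have h3 := congrArg (fun L => L v) h2
  simp only [Nat.cast_ofNat, Nat.add_one_sub_one, pow_one, _root_.zero_apply, _root_.sub_apply,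
    _root_.smul_apply, nsmul_eq_mul, smul_eq_mul] at h3
  have h4 : 2 * ‖M x₀‖ * (fderiv ℝ (fun x => ‖N x‖) x₀ v - fderiv ℝ (fun x => ‖M x‖) x₀ v) = 0 := by
    linarith
  have := (mul_eq_zero.1 h4).resolve_left (by positivity)
  linarith

/-- `V (Wᴴ D V)⁻¹ Wᴴ D` is a projection onto the column space of `V`, hence fixes `D⁻¹ B`. -/
theorem mul_inv_mul_eq_of_right {V W : Matrix (Fin n) (Fin r) ℂ} {D : Matrix (Fin n) (Fin n) ℂ}
    {B : Matrix (Fin n) (Fin m) ℂ} {Y : Matrix (Fin r) (Fin m) ℂ} (hD : D.det ≠ 0)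
    (hred : (Wᴴ * D * V).det ≠ 0) (hY : V * Y = D⁻¹ * B) :
    V * (Wᴴ * D * V)⁻¹ * (Wᴴ * B) = D⁻¹ * B := by
  have hB : B = D * (V * Y) := by
    rw [hY, ← Matrix.mul_assoc, Matrix.mul_nonsing_inv _ (isUnit_iff_ne_zero.2 hD), Matrix.one_mul]
  have h1 : Wᴴ * B = Wᴴ * D * V * Y := by
    rw [hB]; simp only [Matrix.mul_assoc]
  rw [h1, Matrix.mul_assoc, Matrix.nonsing_inv_mul_cancel_left _ _ (isUnit_iff_ne_zero.2 hred), hY]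

/-- The right space alone gives equality of values. For the gradient, `(M x₀)ᴴ` times the error
factors as left residual times `D⁻¹ - V (Wᴴ D V)⁻¹ Wᴴ` times right residual. Both residuals vanish
at `x₀`, so the product is of second order. -/
theorem fderiv_norm_reduced_eq {D : X → Matrix (Fin n) (Fin n) ℂ} {B : X → Matrix (Fin n) (Fin m) ℂ}
    {C : X → Matrix (Fin p) (Fin n) ℂ} {V W : Matrix (Fin n) (Fin r) ℂ} {x₀ : X}
    (hD : ContDiffAt ℝ 1 D x₀) (hB : ContDiffAt ℝ 1 B x₀) (hC : ContDiffAt ℝ 1 C x₀)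
    (hdet : (D x₀).det ≠ 0) (hred : (Wᴴ * D x₀ * V).det ≠ 0)
    (hV : ∃ Y : Matrix (Fin r) (Fin m) ℂ, V * Y = (D x₀)⁻¹ * B x₀)
    (hW : ∃ Y : Matrix (Fin r) (Fin m) ℂ, W * Y = ((D x₀)⁻¹)ᴴ * (C x₀)ᴴ * (C x₀ * (D x₀)⁻¹ * B x₀))
    (hpos : 0 < ‖C x₀ * (D x₀)⁻¹ * B x₀‖)
    (hn : DifferentiableAt ℝ (fun N : Matrix (Fin p) (Fin m) ℂ => ‖N‖) (C x₀ * (D x₀)⁻¹ * B x₀)) :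
    C x₀ * V * (Wᴴ * D x₀ * V)⁻¹ * (Wᴴ * B x₀) = C x₀ * (D x₀)⁻¹ * B x₀ ∧
    fderiv ℝ (fun x => ‖C x * V * (Wᴴ * D x * V)⁻¹ * (Wᴴ * B x)‖) x₀ =
      fderiv ℝ (fun x => ‖C x * (D x)⁻¹ * B x‖) x₀ := by
  obtain ⟨Y, hY⟩ := hV
  obtain ⟨Z, hZ⟩ := hW
  have hval : C x₀ * V * (Wᴴ * D x₀ * V)⁻¹ * (Wᴴ * B x₀) = C x₀ * (D x₀)⁻¹ * B x₀ := by
    rw [Matrix.mul_assoc (C x₀) (D x₀)⁻¹, ← mul_inv_mul_eq_of_right hdet hred hY]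
    simp only [Matrix.mul_assoc]
  have cI := ContDiffAt.matrix_inv hD hdet
  have cR : ContDiffAt ℝ 1 (fun x => Wᴴ * D x * V) x₀ :=
    ContDiffAt.matrix_mul (ContDiffAt.matrix_mul contDiffAt_const hD) contDiffAt_const
  have cRI := ContDiffAt.matrix_inv cR hred
  refine ⟨hval, fderiv_norm_eq_of_isLittleO
    (ContDiffAt.matrix_mul (ContDiffAt.matrix_mul hC cI) hB)
    (ContDiffAt.matrix_mul (ContDiffAt.matrix_mul (ContDiffAt.matrix_mul hC contDiffAt_const) cRI)
      (ContDiffAt.matrix_mul contDiffAt_const hB)) hval hn hpos ?_⟩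
  set M₀ := C x₀ * (D x₀)⁻¹ * B x₀ with hM₀
  have hA0 : M₀ᴴ * C x₀ - Zᴴ * Wᴴ * D x₀ = 0 := by
    have h1 : Zᴴ * Wᴴ = M₀ᴴ * C x₀ * (D x₀)⁻¹ := by
      rw [← Matrix.conjTranspose_mul, hZ]
      simp [Matrix.conjTranspose_mul, Matrix.mul_assoc]
    rw [h1, Matrix.mul_assoc, Matrix.nonsing_inv_mul _ (isUnit_iff_ne_zero.2 hdet), Matrix.mul_one,
      sub_self]
  have hR0 : B x₀ - D x₀ * V * Y = 0 := by
    rw [Matrix.mul_assoc, hY, ← Matrix.mul_assoc,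
      Matrix.mul_nonsing_inv _ (isUnit_iff_ne_zero.2 hdet), Matrix.one_mul, sub_self]
  have hA : ContDiffAt ℝ 1 (fun x => M₀ᴴ * C x - Zᴴ * Wᴴ * D x) x₀ :=
    (ContDiffAt.matrix_mul contDiffAt_const hC).sub (ContDiffAt.matrix_mul contDiffAt_const hD)
  have hR : ContDiffAt ℝ 1 (fun x => ((D x)⁻¹ - V * (Wᴴ * D x * V)⁻¹ * Wᴴ) * (B x - D x * V * Y)) x₀ :=
    ContDiffAt.matrix_mul
      (cI.sub (ContDiffAt.matrix_mul (ContDiffAt.matrix_mul contDiffAt_const cRI) contDiffAt_const))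
      (hB.sub (ContDiffAt.matrix_mul (ContDiffAt.matrix_mul hD contDiffAt_const) contDiffAt_const))
  refine (isLittleO_norm_mul hA hR hA0 (by rw [hR0, Matrix.mul_zero])).congr' ?_ EventuallyEq.rfl
  filter_upwards [(ContDiffAt.matrix_det hD).continuousAt.eventually_ne hdet,
    (ContDiffAt.matrix_det cR).continuousAt.eventually_ne hred] with x hx hx'
  congr 1
  have hu := isUnit_iff_ne_zero.2 hx
  have hu' := isUnit_iff_ne_zero.2 hx'
  -- `hright` and `hleft` are the Galerkin orthogonalities: the middle factor annihilates `D V` on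
  -- its right and `Wᴴ D` on its left, so the residual corrections can be inserted for free.
  have hright : ((D x)⁻¹ - V * (Wᴴ * D x * V)⁻¹ * Wᴴ) * (D x * V * Y) = 0 := by
    rw [Matrix.sub_mul, sub_eq_zero]
    have h1 : V * (Wᴴ * D x * V)⁻¹ * Wᴴ * (D x * V * Y) =
        V * ((Wᴴ * D x * V)⁻¹ * (Wᴴ * D x * V)) * Y := by simp only [Matrix.mul_assoc]
    rw [h1, Matrix.nonsing_inv_mul _ hu', Matrix.mul_one, Matrix.mul_assoc (D x),
      Matrix.nonsing_inv_mul_cancel_left _ _ hu]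
  have hleft : Zᴴ * Wᴴ * D x * ((D x)⁻¹ - V * (Wᴴ * D x * V)⁻¹ * Wᴴ) = 0 := by
    rw [Matrix.mul_sub, sub_eq_zero]
    have h1 : Zᴴ * Wᴴ * D x * (V * (Wᴴ * D x * V)⁻¹ * Wᴴ) =
        Zᴴ * ((Wᴴ * D x * V) * (Wᴴ * D x * V)⁻¹) * Wᴴ := by simp only [Matrix.mul_assoc]
    rw [h1, Matrix.mul_nonsing_inv _ hu', Matrix.mul_one, Matrix.mul_nonsing_inv_cancel_right _ _ hu]
  rw [Matrix.mul_sub _ (B x), hright, sub_zero, Matrix.sub_mul, ← Matrix.mul_assoc _ _ (B x),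
    ← Matrix.mul_assoc _ _ (B x), hleft, Matrix.zero_mul, sub_zero]
  simp only [Matrix.mul_assoc, Matrix.sub_mul, Matrix.mul_sub]

/-- Conjugate transposition exchanges `V` with `W`, `B` with `Cᴴ` and `m` with `p`, and preserves
the norm. -/
theorem fderiv_norm_reduced_eq_dual {D : X → Matrix (Fin n) (Fin n) ℂ}
    {B : X → Matrix (Fin n) (Fin m) ℂ}
    {C : X → Matrix (Fin p) (Fin n) ℂ} {V W : Matrix (Fin n) (Fin r) ℂ} {x₀ : X}
    (hD : ContDiffAt ℝ 1 D x₀) (hB : ContDiffAt ℝ 1 B x₀) (hC : ContDiffAt ℝ 1 C x₀)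
    (hdet : (D x₀).det ≠ 0) (hred : (Wᴴ * D x₀ * V).det ≠ 0)
    (hV : ∃ Y : Matrix (Fin r) (Fin p) ℂ, V * Y = (D x₀)⁻¹ * B x₀ * (C x₀ * (D x₀)⁻¹ * B x₀)ᴴ)
    (hW : ∃ Y : Matrix (Fin r) (Fin p) ℂ, W * Y = ((D x₀)⁻¹)ᴴ * (C x₀)ᴴ)
    (hpos : 0 < ‖C x₀ * (D x₀)⁻¹ * B x₀‖)
    (hn : DifferentiableAt ℝ (fun N : Matrix (Fin p) (Fin m) ℂ => ‖N‖) (C x₀ * (D x₀)⁻¹ * B x₀)) :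
    C x₀ * V * (Wᴴ * D x₀ * V)⁻¹ * (Wᴴ * B x₀) = C x₀ * (D x₀)⁻¹ * B x₀ ∧
    fderiv ℝ (fun x => ‖C x * V * (Wᴴ * D x * V)⁻¹ * (Wᴴ * B x)‖) x₀ =
      fderiv ℝ (fun x => ‖C x * (D x)⁻¹ * B x‖) x₀ := by
  have t1 : ∀ x, (B x)ᴴ * ((D x)ᴴ)⁻¹ * (C x)ᴴ = (C x * (D x)⁻¹ * B x)ᴴ := fun x => by
    simp [Matrix.conjTranspose_mul, Matrix.mul_assoc, Matrix.conjTranspose_nonsing_inv]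
  have t2 : ∀ x, (B x)ᴴ * W * (Vᴴ * (D x)ᴴ * W)⁻¹ * (Vᴴ * (C x)ᴴ) =
      (C x * V * (Wᴴ * D x * V)⁻¹ * (Wᴴ * B x))ᴴ := fun x => by
    simp [Matrix.conjTranspose_mul, Matrix.mul_assoc, Matrix.conjTranspose_nonsing_inv]
  have hred' : (Vᴴ * (D x₀)ᴴ * W).det ≠ 0 := by
    have : Vᴴ * (D x₀)ᴴ * W = (Wᴴ * D x₀ * V)ᴴ := by
      simp [Matrix.conjTranspose_mul, Matrix.mul_assoc]
    rw [this, Matrix.det_conjTranspose]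
    simpa using hred
  have hn' : DifferentiableAt ℝ (fun N : Matrix (Fin m) (Fin p) ℂ => ‖N‖)
      (C x₀ * (D x₀)⁻¹ * B x₀)ᴴ := by
    have e : (fun N : Matrix (Fin m) (Fin p) ℂ => ‖N‖) = fun N => ‖Nᴴ‖ := by
      funext N; rw [Matrix.l2_opNorm_conjTranspose]
    rw [e]
    exact differentiableAt_norm_comp (ContDiffAt.matrix_conjTranspose contDiffAt_id) (by simpa using hn)
  have := fderiv_norm_reduced_eq (V := W) (W := V) (ContDiffAt.matrix_conjTranspose hD)
    (ContDiffAt.matrix_conjTranspose hC) (ContDiffAt.matrix_conjTranspose hB)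
    (by rw [Matrix.det_conjTranspose]; simpa using hdet) hred'
    (by rw [← Matrix.conjTranspose_nonsing_inv]; exact hW)
    (by
      rw [t1, ← Matrix.conjTranspose_nonsing_inv, Matrix.conjTranspose_conjTranspose,
        Matrix.conjTranspose_conjTranspose]
      exact hV)
    (by rw [t1, Matrix.l2_opNorm_conjTranspose]; exact hpos) (by rw [t1]; exact hn')
  simp only [t1, t2, Matrix.l2_opNorm_conjTranspose] at this
  exact ⟨Matrix.conjTranspose_injective this.1, this.2⟩

theorem exists_mul_eq_of_colSpace_le {M : Matrix (Fin n) (Fin m) ℂ} {V : Matrix (Fin n) (Fin r) ℂ}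
    (h : colSpace M ≤ colSpace V) : ∃ Y : Matrix (Fin r) (Fin m) ℂ, V * Y = M := by
  have : ∀ j, ∃ y : Fin r → ℂ, V *ᵥ y = fun i => M i j := by
    intro j
    have h1 : (fun i => M i j) ∈ colSpace M := ⟨Pi.single j 1, by ext i; simp⟩
    exact h h1
  choose y hy using this
  refine ⟨Matrix.of fun i j => y j i, ?_⟩
  ext i j
  exact congrFun (hy j) i

end Interpolation

/-- Pairs of matrices which serve as right and left reduction bases. -/
abbrev BasisPair (n r : ℕ) : Type := Matrix (Fin n) (Fin r) ℂ × Matrix (Fin n) (Fin r) ℂ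

/-! ### The reduced singular value as a function of bases, parameter and frequency -/

namespace ParamSystem

variable {d n m p r : ℕ} (S : ParamSystem d n m p)

/-- The pencil of the full system on the imaginary axis. -/
def pencil (μ : Param d) (ω : ℝ) : Matrix (Fin n) (Fin n) ℂ := (S.full μ).D (Complex.I * ω)

/-- The pencil of the reduced system on the imaginary axis. -/
def redPencil (θ : BasisPair n r) (μ : Param d) (ω : ℝ) : Matrix (Fin r) (Fin r) ℂ :=
  θ.2ᴴ * S.pencil μ ω * θ.1

/-- The transfer function of the reduced system on the imaginary axis. -/
noncomputable def redTransfer (θ : BasisPair n r) (μ : Param d) (ω : ℝ) : Matrix (Fin p) (Fin m) ℂ :=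
  (S.full μ).C * θ.1 * (S.redPencil θ μ ω)⁻¹ * (θ.2ᴴ * (S.full μ).B)

/-- The largest singular value of the reduced transfer function, as a function of the bases,
the parameter and the frequency. -/
noncomputable def redSigma (y : (BasisPair n r × Param d) × ℝ) : ℝ :=
  (S.reduced y.1.1.1 y.1.1.2 y.1.2).sigma y.2

theorem reduced_D (V W : Matrix (Fin n) (Fin r) ℂ) (μ : Param d) (s : ℂ) :
    (S.reduced V W μ).D s = Wᴴ * (S.full μ).D s * V := by
  simp only [Descriptor.D, reduced, full, Matrix.mul_sub, Matrix.sub_mul, Matrix.mul_sum,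
    Matrix.sum_mul, Matrix.mul_smul, Matrix.smul_mul, Finset.smul_sum]

theorem reduced_B (V W : Matrix (Fin n) (Fin r) ℂ) (μ : Param d) :
    (S.reduced V W μ).B = Wᴴ * (S.full μ).B := by
  simp only [reduced, full, Matrix.mul_sum, Matrix.mul_smul]

theorem reduced_C (V W : Matrix (Fin n) (Fin r) ℂ) (μ : Param d) :
    (S.reduced V W μ).C = (S.full μ).C * V := by
  simp only [reduced, full, Matrix.sum_mul, Matrix.smul_mul]

/-- The full problem is the reduction by identity bases, so every statement about `redSigma` also
covers the full singular value. -/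
theorem reduced_one (μ : Param d) : S.reduced 1 1 μ = S.full μ := by
  simp [reduced, full]

theorem reduced_H {θ : BasisPair n r} {μ : Param d} {ω : ℝ} (h : (S.redPencil θ μ ω).det ≠ 0) :
    (S.reduced θ.1 θ.2 μ).H (Complex.I * ω) = S.redTransfer θ μ ω := by
  have h1 : (S.reduced θ.1 θ.2 μ).D (Complex.I * ω) = S.redPencil θ μ ω := S.reduced_D _ _ _ _
  rw [Descriptor.H_eq _ (by rw [h1]; exact h), h1, reduced_B, reduced_C]
  rfl

theorem redSigma_eq {y : (BasisPair n r × Param d) × ℝ}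
    (h : (S.redPencil y.1.1 y.1.2 y.2).det ≠ 0) :
    S.redSigma y = ‖S.redTransfer y.1.1 y.1.2 y.2‖ := by
  rw [redSigma, Descriptor.sigma_eq_norm, reduced_H S h]

variable {S} {Ω : Set (Param d)} {X : Type*} [NormedAddCommGroup X] [NormedSpace ℝ X]
  {k : WithTop ℕ∞} {u : X → Param d} {v : X → ℝ} {x₀ : X}

theorem contDiffAt_sum_smul {ι : Type*} [Fintype ι] {a b : ℕ} {f : ι → Param d → ℝ}
    {M : ι → Matrix (Fin a) (Fin b) ℂ} (hf : ∀ j, AnalyticOnNhd ℝ (f j) Ω)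
    (hu : ContDiffAt ℝ k u x₀) (hx : u x₀ ∈ Ω) :
    ContDiffAt ℝ k (fun x => ∑ j, (f j (u x) : ℂ) • M j) x₀ :=
  ContDiffAt.sum fun j _ => ContDiffAt.smul
    (Complex.ofRealCLM.contDiff.contDiffAt.comp x₀ ((hf j _ hx).contDiffAt.comp x₀ hu))
    contDiffAt_const

theorem contDiffAt_pencil (hS : S.IsAnalytic Ω) (hu : ContDiffAt ℝ k u x₀) (hv : ContDiffAt ℝ k v x₀)
    (hx : u x₀ ∈ Ω) : ContDiffAt ℝ k (fun x => S.pencil (u x) (v x)) x₀ := by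
  have h : ContDiffAt ℝ k (fun x => Complex.I * (v x : ℂ)) x₀ :=
    contDiffAt_const.mul (Complex.ofRealCLM.contDiff.contDiffAt.comp x₀ hv)
  exact (h.smul (contDiffAt_sum_smul (M := fun j => (S.E j).map Complex.ofReal) hS.1 hu hx)).sub
    (contDiffAt_sum_smul (M := fun j => (S.A j).map Complex.ofReal) hS.2.1 hu hx)

theorem contDiffAt_B (hS : S.IsAnalytic Ω) (hu : ContDiffAt ℝ k u x₀) (hx : u x₀ ∈ Ω) :
    ContDiffAt ℝ k (fun x => (S.full (u x)).B) x₀ :=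
  contDiffAt_sum_smul hS.2.2.1 hu hx

theorem contDiffAt_C (hS : S.IsAnalytic Ω) (hu : ContDiffAt ℝ k u x₀) (hx : u x₀ ∈ Ω) :
    ContDiffAt ℝ k (fun x => (S.full (u x)).C) x₀ :=
  contDiffAt_sum_smul hS.2.2.2 hu hx

theorem contDiffAt_redPencil (hS : S.IsAnalytic Ω) {y₀ : (BasisPair n r × Param d) × ℝ}
    (hy : y₀.1.2 ∈ Ω) :
    ContDiffAt ℝ k (fun y : (BasisPair n r × Param d) × ℝ => S.redPencil y.1.1 y.1.2 y.2) y₀ :=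
  ContDiffAt.matrix_mul (ContDiffAt.matrix_mul
    (ContDiffAt.matrix_conjTranspose contDiffAt_fst.fst.snd)
    (contDiffAt_pencil hS contDiffAt_fst.snd contDiffAt_snd hy)) contDiffAt_fst.fst.fst

theorem eventually_det_redPencil_ne_zero (hS : S.IsAnalytic Ω)
    {y₀ : (BasisPair n r × Param d) × ℝ} (hy : y₀.1.2 ∈ Ω)
    (hdet : (S.redPencil y₀.1.1 y₀.1.2 y₀.2).det ≠ 0) :
    ∀ᶠ y in 𝓝 y₀, (S.redPencil y.1.1 y.1.2 y.2).det ≠ 0 :=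
  (ContDiffAt.matrix_det (k := 0) (contDiffAt_redPencil hS hy)).continuousAt.eventually_ne hdet

theorem contDiffAt_redTransfer (hS : S.IsAnalytic Ω) {y₀ : (BasisPair n r × Param d) × ℝ}
    (hy : y₀.1.2 ∈ Ω) (hdet : (S.redPencil y₀.1.1 y₀.1.2 y₀.2).det ≠ 0) :
    ContDiffAt ℝ k (fun y : (BasisPair n r × Param d) × ℝ => S.redTransfer y.1.1 y.1.2 y.2) y₀ :=
  ContDiffAt.matrix_mul (ContDiffAt.matrix_mul (ContDiffAt.matrix_mul
    (contDiffAt_C hS contDiffAt_fst.snd hy) contDiffAt_fst.fst.fst)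
    (ContDiffAt.matrix_inv (contDiffAt_redPencil hS hy) hdet))
    (ContDiffAt.matrix_mul (ContDiffAt.matrix_conjTranspose contDiffAt_fst.fst.snd)
      (contDiffAt_B hS contDiffAt_fst.snd hy))

theorem contDiffAt_redSigma (hS : S.IsAnalytic Ω) {y₀ : (BasisPair n r × Param d) × ℝ}
    (hy : y₀.1.2 ∈ Ω) (hdet : (S.redPencil y₀.1.1 y₀.1.2 y₀.2).det ≠ 0)
    (hn : ContDiffAt ℝ 4 (fun M : Matrix (Fin p) (Fin m) ℂ => ‖M‖)
      (S.redTransfer y₀.1.1 y₀.1.2 y₀.2)) : ContDiffAt ℝ 4 S.redSigma y₀ := by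
  refine ContDiffAt.congr_of_eventuallyEq (ContDiffAt.comp
    (g := fun M : Matrix (Fin p) (Fin m) ℂ => ‖M‖) y₀ hn (contDiffAt_redTransfer hS hy hdet)) ?_
  filter_upwards [eventually_det_redPencil_ne_zero hS hy hdet] with y h
  exact S.redSigma_eq h

/-- The bases `θ` contain the directions obtained by expansion at `(μ, ω)`. -/
def Contains (S : ParamSystem d n m p) (θ : BasisPair n r) (μ : Param d) (ω : ℝ) : Prop :=
  (S.full μ).expandV ω ≤ colSpace θ.1 ∧ (S.full μ).expandW ω ≤ colSpace θ.2

theorem redPencil_one (μ : Param d) (ω : ℝ) : S.redPencil (1 : BasisPair n n) μ ω = S.pencil μ ω := by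
  simp [redPencil]

/-- For `m ≤ p` the right space contains all of `D⁻¹ B` and the direct version applies; for `m > p`
the left space contains all of `D⁻*C*` and the dual one does. -/
theorem Contains.interpolates {θ : BasisPair n r} {μ : Param d} {ω : ℝ}
    (h : S.Contains θ μ ω) (hS : S.IsAnalytic Ω) (hμ : μ ∈ Ω) (hdet : (S.pencil μ ω).det ≠ 0)
    (hred : (S.redPencil θ μ ω).det ≠ 0)
    (hpos : 0 < ‖S.redTransfer (1 : BasisPair n n) μ ω‖)
    (hn : DifferentiableAt ℝ (fun M : Matrix (Fin p) (Fin m) ℂ => ‖M‖) (S.redTransfer (1 : BasisPair n n) μ ω)) :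
    S.redTransfer θ μ ω = S.redTransfer (1 : BasisPair n n) μ ω ∧
    fderiv ℝ (fun z : Param d × ℝ => S.redSigma ((θ, z.1), z.2)) (μ, ω) =
      fderiv ℝ (fun z : Param d × ℝ => S.redSigma (((1 : BasisPair n n), z.1), z.2)) (μ, ω) := by
  have h1 : ∀ z : Param d × ℝ, S.redTransfer (1 : BasisPair n n) z.1 z.2 =
      (S.full z.1).C * (S.pencil z.1 z.2)⁻¹ * (S.full z.1).B := fun z => by
    simp [redTransfer, redPencil]
  have hdet1 : (S.redPencil (1 : BasisPair n n) μ ω).det ≠ 0 := by rwa [redPencil_one]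
  have hH : (S.full μ).H (Complex.I * ω) = (S.full μ).C * (S.pencil μ ω)⁻¹ * (S.full μ).B :=
    Descriptor.H_eq _ hdet
  have ev : ∀ {r : ℕ} (θ : BasisPair n r), (S.redPencil θ μ ω).det ≠ 0 →
      (fun z : Param d × ℝ => S.redSigma ((θ, z.1), z.2)) =ᶠ[𝓝 (μ, ω)]
        fun z => ‖S.redTransfer θ z.1 z.2‖ := by
    intro r θ hθ
    have hc : Continuous (fun z : Param d × ℝ => ((θ, z.1), z.2)) := by fun_prop
    have := (hc.tendsto (μ, ω)).eventually
      (eventually_det_redPencil_ne_zero (y₀ := ((θ, μ), ω)) hS hμ hθ)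
    filter_upwards [this] with z hz
    exact S.redSigma_eq hz
  rw [(ev θ hred).fderiv_eq, (ev (1 : BasisPair n n) hdet1).fderiv_eq]
  have e1 := h1 (μ, ω)
  simp only at e1
  rw [e1] at hpos hn
  have cD : ContDiffAt ℝ 1 (fun z : Param d × ℝ => S.pencil z.1 z.2) (μ, ω) :=
    contDiffAt_pencil hS contDiffAt_fst contDiffAt_snd hμ
  have cB : ContDiffAt ℝ 1 (fun z : Param d × ℝ => (S.full z.1).B) (μ, ω) :=
    contDiffAt_B hS contDiffAt_fst hμ
  have cC : ContDiffAt ℝ 1 (fun z : Param d × ℝ => (S.full z.1).C) (μ, ω) :=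
    contDiffAt_C hS contDiffAt_fst hμ
  simp only [h1]
  rw [e1]
  simp only [redTransfer, redPencil] at hred ⊢
  obtain ⟨hV, hW⟩ := h
  unfold Descriptor.expandV at hV
  unfold Descriptor.expandW at hW
  rw [hH] at hV hW
  rcases le_or_gt m p with hmp | hmp
  · rw [if_pos hmp] at hV
    refine fderiv_norm_reduced_eq (D := fun z : Param d × ℝ => S.pencil z.1 z.2)
      (B := fun z => (S.full z.1).B) (C := fun z => (S.full z.1).C) (V := θ.1) (W := θ.2)
      (x₀ := (μ, ω)) cD cB cC hdet hred (exists_mul_eq_of_colSpace_le hV) ?_ hpos hn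
    -- The first branch is `m = p`: the left space contains `D⁻*C*`, hence also its product with
    -- `H`.
    split_ifs at hW with hpm
    · obtain ⟨Y, hY⟩ := exists_mul_eq_of_colSpace_le hW
      exact ⟨Y * ((S.full μ).C * (S.pencil μ ω)⁻¹ * (S.full μ).B), by
        rw [← Matrix.mul_assoc, hY]; rfl⟩
    · exact exists_mul_eq_of_colSpace_le hW
  · rw [if_neg (not_le.2 hmp)] at hV
    rw [if_pos hmp.le] at hW
    exact fderiv_norm_reduced_eq_dual (D := fun z : Param d × ℝ => S.pencil z.1 z.2)
      (B := fun z => (S.full z.1).B) (C := fun z => (S.full z.1).C) (V := θ.1) (W := θ.2)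
      (x₀ := (μ, ω)) cD cB cC hdet hred (exists_mul_eq_of_colSpace_le hV)
      (exists_mul_eq_of_colSpace_le hW) hpos hn

end ParamSystem

end HinfMin

namespace HinfMin

/-! ### Frequency derivatives, the envelope theorem and perturbation of inverses -/

section Auxiliary

variable {E : Type*} [NormedAddCommGroup E] [NormedSpace ℝ E]

theorem hasDerivAt_of_contDiffAt {Φ : E × ℝ → ℝ} {k : WithTop ℕ∞} (hk : k ≠ 0) {x : E} {ω : ℝ}
    (h : ContDiffAt ℝ k Φ (x, ω)) :
    HasDerivAt (fun t => Φ (x, t)) (fderiv ℝ Φ (x, ω) (0, 1)) ω :=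
  HasFDerivAt.comp_hasDerivAt (l := Φ) (f := fun t : ℝ => (x, t)) ω
    (h.differentiableAt hk).hasFDerivAt ((hasDerivAt_const _ _).prodMk (hasDerivAt_id _))

theorem iteratedDeriv_two_eq_fderiv {Φ : E × ℝ → ℝ} {x : E} {ω : ℝ}
    (h : ContDiffAt ℝ 4 Φ (x, ω)) :
    iteratedDeriv 2 (fun t => Φ (x, t)) ω =
      fderiv ℝ (fun z => fderiv ℝ Φ z (0, 1)) (x, ω) (0, 1) := by
  have cΨ : ContDiffAt ℝ 3 (fun z => fderiv ℝ Φ z (0, 1)) (x, ω) :=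
    (h.fderiv_right (m := 3) (by norm_num)).clm_apply contDiffAt_const
  rw [iteratedDeriv_succ, iteratedDeriv_one]
  have : deriv (fun t => Φ (x, t)) =ᶠ[𝓝 ω] fun t => fderiv ℝ Φ (x, t) (0, 1) := by
    have := (Continuous.prodMk_right (X := E) (Y := ℝ) x).tendsto ω |>.eventually
      (h.eventually (by simp))
    filter_upwards [this] with t ht
    exact (hasDerivAt_of_contDiffAt (by simp) ht).deriv
  rw [this.deriv_eq, (hasDerivAt_of_contDiffAt (by simp) cΨ).deriv]

theorem continuousAt_iteratedDeriv_two {Φ : E × ℝ → ℝ} {x₀ : E} {ω₀ : ℝ}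
    (h : ContDiffAt ℝ 4 Φ (x₀, ω₀)) :
    ContinuousAt (fun x => iteratedDeriv 2 (fun t => Φ (x, t)) ω₀) x₀ := by
  have cΨ : ContDiffAt ℝ 3 (fun z => fderiv ℝ Φ z (0, 1)) (x₀, ω₀) :=
    (h.fderiv_right (m := 3) (by norm_num)).clm_apply contDiffAt_const
  have cχ : ContDiffAt ℝ 2 (fun z => fderiv ℝ (fun z => fderiv ℝ Φ z (0, 1)) z (0, 1)) (x₀, ω₀) :=
    (cΨ.fderiv_right (m := 2) (by norm_num)).clm_apply contDiffAt_const
  have hc : ContinuousAt (fun x : E => (x, ω₀)) x₀ := by fun_prop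
  refine (ContinuousAt.comp (f := fun x : E => (x, ω₀)) cχ.continuousAt hc).congr ?_
  filter_upwards [hc.tendsto.eventually (h.eventually (by simp))] with x hx
  exact (iteratedDeriv_two_eq_fderiv hx).symm

/-- The envelope theorem: along a stationary branch the derivative of `w` drops out. -/
theorem hasFDerivAt_comp_of_stationary {σ : E × ℝ → ℝ} {w : E → ℝ} {x : E}
    (hσ : DifferentiableAt ℝ σ (x, w x)) (hw : DifferentiableAt ℝ w x)
    (h0 : fderiv ℝ σ (x, w x) (0, 1) = 0) :
    HasFDerivAt (fun y => σ (y, w y)) (fderiv ℝ σ (x, w x) ∘L .inl ℝ E ℝ) x := by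
  have h1 := HasFDerivAt.comp (g := σ) (f := fun y => (y, w y)) x hσ.hasFDerivAt
    ((hasFDerivAt_id x).prodMk hw.hasFDerivAt)
  convert! h1 using 1
  ext v
  have : ((v, fderiv ℝ w x v) : E × ℝ) = (v, 0) + fderiv ℝ w x v • ((0 : E), (1 : ℝ)) := by
    ext <;> simp
  simp only [ContinuousLinearMap.comp_apply, ContinuousLinearMap.inl_apply,
    ContinuousLinearMap.prod_apply, ContinuousLinearMap.id_apply]
  rw [this, map_add, map_smul, h0, smul_zero, add_zero]

theorem exists_norm_inv_le {d : ℕ} {A₀ : Matrix (Fin d) (Fin d) ℝ} (h : IsUnit A₀) :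
    ∃ K : ℝ, 0 ≤ K ∧ ∀ᶠ A in 𝓝 A₀, IsUnit A ∧ ‖A⁻¹‖ ≤ K := by
  refine ⟨‖A₀⁻¹‖ + 1, by positivity, ?_⟩
  obtain ⟨u, rfl⟩ := h
  have hc : ContinuousAt (fun A : Matrix (Fin d) (Fin d) ℝ => ‖A⁻¹‖) (u : Matrix (Fin d) (Fin d) ℝ) := by
    have := NormedRing.inverse_continuousAt u
    exact ContinuousAt.norm (f := fun A : Matrix (Fin d) (Fin d) ℝ => A⁻¹) (by
      convert! this using 1
      funext A
      exact Matrix.nonsing_inv_eq_ringInverse A)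
  filter_upwards [Units.nhds u, hc.eventually_lt_const (lt_add_one _)] with A h1 h2
  exact ⟨h1, h2.le⟩

theorem norm_inv_sub_inv_le {d : ℕ} {A B : Matrix (Fin d) (Fin d) ℝ} (hA : IsUnit A) (hB : IsUnit B)
    {K : ℝ} (h1 : ‖A⁻¹‖ ≤ K) (h2 : ‖B⁻¹‖ ≤ K) : ‖A⁻¹ - B⁻¹‖ ≤ K * ‖A - B‖ * K := by
  have hA' := (Matrix.isUnit_iff_isUnit_det _).1 hA
  have hB' := (Matrix.isUnit_iff_isUnit_det _).1 hB
  have : A⁻¹ - B⁻¹ = A⁻¹ * (B - A) * B⁻¹ := by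
    rw [Matrix.mul_sub, Matrix.sub_mul, Matrix.nonsing_inv_mul _ hA', Matrix.mul_assoc,
      Matrix.mul_nonsing_inv _ hB', Matrix.mul_one, Matrix.one_mul]
  rw [this, norm_sub_rev A B]
  refine (norm_mul_le _ _).trans ?_
  have h0 : 0 ≤ K := (norm_nonneg _).trans h1
  gcongr
  exact (norm_mul_le _ _).trans (by gcongr)

theorem continuousAt_hessian {d : ℕ} {F : Param d → ℝ} {x : Param d} (hF : ContDiffAt ℝ 3 F x) :
    ContinuousAt (hessian F) x := by
  have h2 : ContDiffAt ℝ 1 (fderiv ℝ (fderiv ℝ F)) x :=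
    (hF.fderiv_right (m := 2) (by norm_num)).fderiv_right (by norm_num)
  have : ∀ i j, ContinuousAt (fun y => hessian F y i j) x := by
    intro i j
    simp only [hessian_apply]
    exact (h2.continuousAt.clm_apply continuousAt_const).clm_apply continuousAt_const
  exact tendsto_pi_nhds.2 fun i => tendsto_pi_nhds.2 fun j => this i j

/-- It limits the reduced dimension to finitely many values, so constants can be chosen for all of
them at once. -/
theorem card_le_of_conjTranspose_mul_self_eq_one {n r : ℕ} {V : Matrix (Fin n) (Fin r) ℂ}
    (h : Vᴴ * V = 1) : r ≤ n := by
  have hinj : Function.Injective V.mulVecLin := by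
    intro x y hxy
    have h1 : Vᴴ *ᵥ (V *ᵥ x) = Vᴴ *ᵥ (V *ᵥ y) := congrArg (fun z => Vᴴ *ᵥ z) hxy
    simpa [Matrix.mulVec_mulVec, h] using h1
  simpa using LinearMap.finrank_le_finrank_of_injective hinj

end Auxiliary

/-! ### The peak branch of the full problem, and interpolation along it -/

namespace ParamSystem

variable {d n m p r : ℕ} {S : ParamSystem d n m p} {Ω : Set (Param d)}

theorem full_sigma (S : ParamSystem d n m p) (μ : Param d) (ω : ℝ) :
    (S.full μ).sigma ω = S.redSigma (((1 : BasisPair n n), μ), ω) := by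
  have := S.reduced_one μ
  unfold redSigma
  exact congrArg (fun P : Descriptor n m p => P.sigma ω) this.symm

/-- `w` parametrizes the peaks of the full problem near `μ`. -/
structure IsPeakBranchAt (S : ParamSystem d n m p) (w : Param d → ℝ) (μ : Param d) : Prop where
  contDiffAt : ContDiffAt ℝ 3 w μ
  contDiffAt_redSigma : ContDiffAt ℝ 4 (S.redSigma (r := n)) ((1, μ), w μ)
  stationary : HasDerivAt (fun ω => S.redSigma (((1 : BasisPair n n), μ), ω)) 0 (w μ)
  hinfNorm_eq : (S.full μ).hinfNorm = S.redSigma (((1 : BasisPair n n), μ), w μ)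
  eq_of_isPeak : ∀ ω, (S.full μ).IsPeak ω → ω = w μ

/-- Inside a small interval around `ωs` the stationary branch is the strict maximum. Outside,
including infinity, `σ(μ, ·)` stays below its value at `ωs` for `μ` near `μs`. So the global peak is
unique and lies on the branch. -/
theorem exists_peakBranch (hS : S.IsAnalytic Ω) {μs : Param d} (hμs : μs ∈ Ω)
    (hnear : ∀ᶠ μ in 𝓝 μs, (S.full μ).IsHinf)
    (hcont : ∀ ω : OnePoint ℝ, ContinuousAt
      (fun x : Param d × OnePoint ℝ => (S.full x.1).sigmaExt x.2) (μs, ω))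
    {ωs : ℝ} (hmax : ∀ ω : OnePoint ℝ, ω ≠ (ωs : OnePoint ℝ) →
      (S.full μs).sigmaExt ω < (S.full μs).sigma ωs)
    (hωω : iteratedDeriv 2 (S.full μs).sigma ωs < 0)
    (hdet : (S.redPencil (1 : BasisPair n n) μs ωs).det ≠ 0)
    (hn : ContDiffAt ℝ 4 (fun M : Matrix (Fin p) (Fin m) ℂ => ‖M‖)
      (S.redTransfer (1 : BasisPair n n) μs ωs)) :
    ∃ w : Param d → ℝ, w μs = ωs ∧ ContDiffAt ℝ 3 w μs ∧ ∀ᶠ μ in 𝓝 μs, S.IsPeakBranchAt w μ := by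
  have hfs : ∀ μ, (S.full μ).sigma = fun ω => S.redSigma (((1 : BasisPair n n), μ), ω) :=
    fun μ => funext fun ω => S.full_sigma μ ω
  have cΦ : ContDiffAt ℝ 4 (S.redSigma (r := n)) ((1, μs), ωs) :=
    ParamSystem.contDiffAt_redSigma hS (y₀ := (((1 : BasisPair n n), μs), ωs)) hμs hdet hn
  have hmaxR : ∀ ω : ℝ, (S.full μs).sigma ω ≤ (S.full μs).sigma ωs := by
    intro ω
    rcases eq_or_ne ω ωs with rfl | h
    · exact le_rfl
    · exact (hmax ω (by simpa using h)).le
  have hst : HasDerivAt (fun ω => S.redSigma (((1 : BasisPair n n), μs), ω)) 0 ωs := by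
    have h1 := hasDerivAt_of_contDiffAt (by simp) cΦ
    have h2 : IsLocalMax (fun ω => S.redSigma (((1 : BasisPair n n), μs), ω)) ωs := by
      refine Eventually.of_forall fun ω => ?_
      have := hmaxR ω
      rwa [full_sigma, full_sigma] at this
    rwa [h2.hasDerivAt_eq_zero h1] at h1
  obtain ⟨g, hgc, hg0, hg⟩ := exists_stationary_branch cΦ hst (by rwa [hfs] at hωω)
  have hslice : ContDiff ℝ 3 (fun μ : Param d => ((1 : BasisPair n n), μ)) :=
    contDiff_const.prodMk contDiff_id
  refine ⟨fun μ => g (1, μ), hg0, ContDiffAt.comp (g := g) μs hgc hslice.contDiffAt, ?_⟩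
  obtain ⟨η, hη, hη0⟩ := (hg.and self_mem_nhdsWithin).exists
  -- The complement of the interval is compact in the one-point compactification, so the strict
  -- inequality at `μs` extends to nearby `μ` uniformly in the frequency.
  have hK : IsCompact ((fun ω : ℝ => (ω : OnePoint ℝ)) '' Metric.ball ωs η)ᶜ :=
    (OnePoint.isOpenEmbedding_coe.isOpenMap _ Metric.isOpen_ball).isClosed_compl.isCompact
  have hout : ∀ᶠ μ in 𝓝 μs, ∀ ω ∈ ((fun ω : ℝ => (ω : OnePoint ℝ)) '' Metric.ball ωs η)ᶜ,
      (S.full μ).sigmaExt ω < (S.full μ).sigmaExt ωs := by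
    refine hK.eventually_forall_of_forall_eventually fun ω hω => ?_
    have hne : ω ≠ (ωs : OnePoint ℝ) := by
      rintro rfl
      exact hω ⟨ωs, Metric.mem_ball_self hη0, rfl⟩
    have h1 : ContinuousAt (fun x : Param d × OnePoint ℝ =>
        (S.full x.1).sigmaExt (ωs : OnePoint ℝ)) (μs, ω) :=
      ContinuousAt.comp (g := fun x : Param d × OnePoint ℝ => (S.full x.1).sigmaExt x.2)
        (f := fun x : Param d × OnePoint ℝ => (x.1, (ωs : OnePoint ℝ))) (hcont ωs) (by fun_prop)
    exact (hcont ω).eventually_lt h1 (hmax ω hne)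
  have hpull : ∀ᶠ μ in 𝓝 μs, _ := hslice.continuous.tendsto μs |>.eventually hη
  filter_upwards [hpull, hout, hnear] with μ h1 h2 h3
  obtain ⟨i1, i2, i3, i4, -, i6⟩ := h1
  have hle : ∀ ω ∈ Metric.closedBall ωs η,
      S.redSigma (((1 : BasisPair n n), μ), ω) ≤ S.redSigma (((1 : BasisPair n n), μ), g (1, μ)) := by
    intro ω hω
    rcases eq_or_ne ω (g (1, μ)) with h | h
    · rw [h]
    · exact (i6 ω hω h).le
  have hout' : ∀ ω, ω ∉ Metric.ball ωs η → (S.full μ).sigma ω < (S.full μ).sigma ωs := by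
    intro ω hω
    refine h2 (ω : OnePoint ℝ) ?_
    rintro ⟨ω', hω', he⟩
    rw [OnePoint.coe_eq_coe] at he
    exact hω (he ▸ hω')
  refine ⟨ContDiffAt.comp (g := g) μ i2 hslice.contDiffAt, i3, i4, ?_, ?_⟩
  · rw [← full_sigma]
    refine h3.hinfNorm_eq fun ω => ?_
    by_cases hω : ω ∈ Metric.ball ωs η
    · rw [full_sigma, full_sigma]
      exact hle ω (Metric.ball_subset_closedBall hω)
    · refine (hout' ω hω).le.trans ?_
      rw [full_sigma, full_sigma]
      exact hle ωs (Metric.mem_closedBall_self hη0.le)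
  · intro ω hpk
    have hω : ω ∈ Metric.ball ωs η := by
      by_contra hω
      exact absurd (hpk (ωs : OnePoint ℝ)) (not_le.2 (hout' ω hω))
    by_contra hne
    have h4 := i6 ω (Metric.ball_subset_closedBall hω) hne
    have h5 := hpk ((g (1, μ) : ℝ) : OnePoint ℝ)
    change (S.full μ).sigma (g (1, μ)) ≤ _ at h5
    rw [full_sigma, full_sigma] at h5
    exact absurd h5 (not_le.2 h4)

/-- The reduced problem interpolates the full problem to first order at `(μ, ω)`. -/
structure Interpolates (S : ParamSystem d n m p) (θ : BasisPair n r) (μ : Param d) (ω : ℝ) :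
    Prop where
  transfer_eq : S.redTransfer θ μ ω = S.redTransfer (1 : BasisPair n n) μ ω
  sigma_eq : S.redSigma ((θ, μ), ω) = S.redSigma (((1 : BasisPair n n), μ), ω)
  fderiv_eq : fderiv ℝ (fun z : Param d × ℝ => S.redSigma ((θ, z.1), z.2)) (μ, ω) =
    fderiv ℝ (fun z : Param d × ℝ => S.redSigma (((1 : BasisPair n n), z.1), z.2)) (μ, ω)

/-- All requirements of `Contains.interpolates` except containment are open conditions, valid at
`(θ₀, μs)`. -/
theorem eventually_interpolates (hS : S.IsAnalytic Ω) (hΩ : IsOpen Ω) {μs : Param d} (hμs : μs ∈ Ω)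
    {ωs : ℝ} {w : Param d → ℝ} (hw : ContinuousAt w μs) (hw0 : w μs = ωs) {θ₀ : BasisPair n r}
    (hdet : (S.redPencil (1 : BasisPair n n) μs ωs).det ≠ 0)
    (hred : (S.redPencil θ₀ μs ωs).det ≠ 0)
    (hpos : 0 < ‖S.redTransfer (1 : BasisPair n n) μs ωs‖)
    (hn : ContDiffAt ℝ 4 (fun M : Matrix (Fin p) (Fin m) ℂ => ‖M‖)
      (S.redTransfer (1 : BasisPair n n) μs ωs)) :
    ∀ᶠ x : BasisPair n r × Param d in 𝓝 (θ₀, μs),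
      S.Contains x.1 x.2 (w x.2) → S.Interpolates x.1 x.2 (w x.2) := by
  subst hw0
  have t1 : Tendsto (fun x : BasisPair n r × Param d => (((1 : BasisPair n n), x.2), w x.2))
      (𝓝 (θ₀, μs)) (𝓝 (((1 : BasisPair n n), μs), w μs)) := by
    have hs : ContinuousAt (fun x : BasisPair n r × Param d => w x.2) (θ₀, μs) :=
      ContinuousAt.comp (g := w) (f := fun x : BasisPair n r × Param d => x.2) hw continuousAt_snd
    exact (continuousAt_const.prodMk continuousAt_snd).prodMk hs
  have t2 : Tendsto (fun x : BasisPair n r × Param d => (x, w x.2))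
      (𝓝 (θ₀, μs)) (𝓝 ((θ₀, μs), w μs)) := by
    have hs : ContinuousAt (fun x : BasisPair n r × Param d => w x.2) (θ₀, μs) :=
      ContinuousAt.comp (g := w) (f := fun x : BasisPair n r × Param d => x.2) hw continuousAt_snd
    exact continuousAt_id.prodMk hs
  have c3 : ContinuousAt (fun y : (BasisPair n n × Param d) × ℝ => S.redTransfer y.1.1 y.1.2 y.2)
      (((1 : BasisPair n n), μs), w μs) :=
    (contDiffAt_redTransfer (k := 0) hS (y₀ := (((1 : BasisPair n n), μs), w μs))
      hμs hdet).continuousAt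
  have t3 : Tendsto (fun x : BasisPair n r × Param d =>
      S.redTransfer (1 : BasisPair n n) x.2 (w x.2)) (𝓝 (θ₀, μs))
      (𝓝 (S.redTransfer (1 : BasisPair n n) μs (w μs))) := by
    have := c3.tendsto.comp t1
    exact this
  have e1 : ∀ᶠ x : BasisPair n r × Param d in 𝓝 (θ₀, μs),
      (S.redPencil (1 : BasisPair n n) x.2 (w x.2)).det ≠ 0 :=
    t1.eventually (eventually_det_redPencil_ne_zero hS
      (y₀ := (((1 : BasisPair n n), μs), w μs)) hμs hdet)
  have e2 : ∀ᶠ x : BasisPair n r × Param d in 𝓝 (θ₀, μs), (S.redPencil x.1 x.2 (w x.2)).det ≠ 0 :=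
    t2.eventually (eventually_det_redPencil_ne_zero hS (y₀ := ((θ₀, μs), w μs)) hμs hred)
  have e4 : ∀ᶠ x : BasisPair n r × Param d in 𝓝 (θ₀, μs),
      DifferentiableAt ℝ (fun M : Matrix (Fin p) (Fin m) ℂ => ‖M‖)
        (S.redTransfer (1 : BasisPair n n) x.2 (w x.2)) := by
    filter_upwards [t3.eventually (hn.eventually (by simp))] with x hx
    exact hx.differentiableAt (by simp)
  have e5 : ∀ᶠ x : BasisPair n r × Param d in 𝓝 (θ₀, μs), x.2 ∈ Ω :=
    continuousAt_snd.eventually_mem (hΩ.mem_nhds hμs)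
  filter_upwards [e1, e2, t3.norm.eventually_const_lt hpos, e4, e5] with x h1 h2 h3 h4 h5 hc
  have h1' : (S.pencil x.2 (w x.2)).det ≠ 0 := by rwa [redPencil_one] at h1
  obtain ⟨i1, i2⟩ := hc.interpolates hS h5 h1' h2 h3 h4
  refine ⟨i1, ?_, i2⟩
  have s1 := redSigma_eq S (y := ((x.1, x.2), w x.2)) h2
  have s2 := redSigma_eq S (y := (((1 : BasisPair n n), x.2), w x.2)) h1
  exact s1.trans ((congrArg norm i1).trans s2.symm)

end ParamSystem

end HinfMin

namespace HinfMin

/-! ### The Hessian bound, locally and uniformly in the bases -/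

namespace ParamSystem

variable {d n m p r : ℕ} {S : ParamSystem d n m p} {Ω : Set (Param d)}

/-- For all points `μ` and step lengths `h` below `ρ`, the reduced problem given by `θ` has a unique
frequency branch through `(μ, G μ)`, and the Hessian error at `μ` is at most `ζ h`, provided that
`θ` contains the expansions at `μ` and at adjacent points of distance `h`. -/
def HasHessianBound (S : ParamSystem d n m p) (μs : Param d) (ωs δ : ℝ) (G : Param d → ℝ)
    (ζ ηω ημ ρ : ℝ) (θ : BasisPair n r) : Prop :=
  ∀ μ ∈ Metric.ball μs ρ, ∀ h : ℝ, 0 < h → h < ρ → ∀ s : Fin d → Fin d → ℝ, (∀ r q, |s r q| = h) →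
    S.Contains θ μ (G μ) →
    (∀ r q, r ≤ q → S.Contains θ (μ + s r q • eDir r q) (G (μ + s r q • eDir r q))) →
    iteratedDeriv 2 (S.reduced θ.1 θ.2 μs).sigma ωs ≤ δ →
    ∃ w : Param d → ℝ,
      IsFrequencyBranch (fun ν => (S.reduced θ.1 θ.2 ν).sigma) μs ωs ημ ηω μ (G μ) w ∧
      (∀ w' : Param d → ℝ,
        IsFrequencyBranch (fun ν => (S.reduced θ.1 θ.2 ν).sigma) μs ωs ημ ηω μ (G μ) w' →
          EqOn w' w (Metric.closedBall μs ημ)) ∧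
      ContDiffAt ℝ 2 (fun ν => (S.reduced θ.1 θ.2 ν).sigma (w ν)) μ ∧
      ‖hessian (fun ν => (S.full ν).hinfNorm) μ -
        hessian (fun ν => (S.reduced θ.1 θ.2 ν).sigma (w ν)) μ‖ ≤ ζ * h

theorem HasHessianBound.of_not {μs : Param d} {ωs δ ζ ηω ημ ρ : ℝ} {G : Param d → ℝ}
    {θ : BasisPair n r} (h : ∀ μ ∈ Metric.ball μs ρ, S.Contains θ μ (G μ) →
      ¬ iteratedDeriv 2 (S.reduced θ.1 θ.2 μs).sigma ωs ≤ δ) :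
    S.HasHessianBound μs ωs δ G ζ ηω ημ ρ θ :=
  fun μ hμ _ _ _ _ _ hc _ hδ => absurd hδ (h μ hμ hc)

theorem IsPeakBranchAt.fderiv_eq_zero {G : Param d → ℝ} {μ : Param d}
    (h : S.IsPeakBranchAt G μ) :
    fderiv ℝ (fun z : Param d × ℝ => S.redSigma (((1 : BasisPair n n), z.1), z.2)) (μ, G μ) (0, 1) =
      0 := by
  have hc : ContDiffAt ℝ 4 (fun z : Param d × ℝ => S.redSigma (((1 : BasisPair n n), z.1), z.2))
      (μ, G μ) :=
    ContDiffAt.comp (g := S.redSigma (r := n)) (μ, G μ) h.contDiffAt_redSigma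
      ((contDiffAt_const.prodMk contDiffAt_fst).prodMk contDiffAt_snd)
  exact (hasDerivAt_of_contDiffAt (by simp) hc).unique h.stationary

theorem exists_ball_of_eventually {A B : Type*} [PseudoMetricSpace A] [PseudoMetricSpace B]
    {a : A} {b : B} {P : A × B → Prop} (h : ∀ᶠ x in 𝓝 (a, b), P x) :
    ∃ ε > 0, ∀ x ∈ Metric.ball a ε, ∀ y ∈ Metric.ball b ε, P (x, y) := by
  obtain ⟨ε, hε, hb⟩ := Metric.mem_nhds_iff.1 h
  refine ⟨ε, hε, fun x hx y hy => hb ?_⟩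
  rw [← ball_prod_same]
  exact ⟨hx, hy⟩

theorem eventually_lt_nhdsGT {ε : ℝ} (hε : 0 < ε) : ∀ᶠ x in 𝓝[>] (0 : ℝ), 0 < x ∧ x < ε :=
  Ioo_mem_nhdsGT hε

/-- Nothing is known about `θ₀` except invertibility of its reduced pencil. If its value, frequency
derivative or second frequency derivative at `(μs, ωs)` is incompatible with being a limit of
interpolating bases that satisfy the `δ` condition, then no such bases exist nearby. Otherwise the
reduced singular value is smooth at `θ₀` and the Taylor argument applies. The neighbourhood `U` is
fixed before all constants, as the later covering argument requires. -/
theorem eventually_hasHessianBound (hS : S.IsAnalytic Ω) (hΩ : IsOpen Ω) {μs : Param d}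
    (hμs : μs ∈ Ω) {ωs δ : ℝ} (hδ : δ < 0) {G : Param d → ℝ} (hG0 : G μs = ωs)
    (hGc : ContDiffAt ℝ 3 G μs) (hG : ∀ᶠ μ in 𝓝 μs, S.IsPeakBranchAt G μ)
    (hdet : (S.redPencil (1 : BasisPair n n) μs ωs).det ≠ 0)
    (hpos : 0 < ‖S.redTransfer (1 : BasisPair n n) μs ωs‖)
    (hn : ContDiffAt ℝ 4 (fun M : Matrix (Fin p) (Fin m) ℂ => ‖M‖)
      (S.redTransfer (1 : BasisPair n n) μs ωs)) {θ₀ : BasisPair n r}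
    (hred : (S.redPencil θ₀ μs ωs).det ≠ 0) :
    ∃ U ∈ 𝓝 θ₀, ∀ᶠ ζ in atTop, ∀ᶠ ηω in 𝓝[>] (0 : ℝ), ∀ᶠ ημ in 𝓝[>] (0 : ℝ), ∀ᶠ ρ in 𝓝[>] (0 : ℝ),
      ∀ θ ∈ U, S.HasHessianBound μs ωs δ G ζ ηω ημ ρ θ := by
  have hint := eventually_interpolates hS hΩ hμs hGc.continuousAt hG0 hdet hred hpos hn
  have hPk : ∀ᶠ x : BasisPair n r × Param d in 𝓝 (θ₀, μs), S.IsPeakBranchAt G x.2 :=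
    continuousAt_snd.tendsto.eventually hG
  -- degenerate bases, which contain no expansions
  have vac : (∀ᶠ x : BasisPair n r × Param d in 𝓝 (θ₀, μs), S.Contains x.1 x.2 (G x.2) →
      ¬ iteratedDeriv 2 (S.reduced x.1.1 x.1.2 μs).sigma ωs ≤ δ) →
      ∃ U ∈ 𝓝 θ₀, ∀ᶠ ζ in atTop, ∀ᶠ ηω in 𝓝[>] (0 : ℝ), ∀ᶠ ημ in 𝓝[>] (0 : ℝ), ∀ᶠ ρ in 𝓝[>] (0 : ℝ),
      ∀ θ ∈ U, S.HasHessianBound μs ωs δ G ζ ηω ημ ρ θ := by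
    intro h
    obtain ⟨ε, hε, hb⟩ := exists_ball_of_eventually h
    refine ⟨Metric.ball θ₀ ε, Metric.ball_mem_nhds θ₀ hε, Eventually.of_forall fun ζ =>
      Eventually.of_forall fun ηω => Eventually.of_forall fun ημ => ?_⟩
    filter_upwards [eventually_lt_nhdsGT hε] with ρ hρ θ hθ
    exact HasHessianBound.of_not fun μ hμ => hb θ hθ μ (Metric.ball_subset_ball hρ.2.le hμ)
  have tG : Tendsto (fun x : BasisPair n r × Param d => (x, G x.2)) (𝓝 (θ₀, μs))
      (𝓝 ((θ₀, μs), ωs)) := by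
    have hs : ContinuousAt (fun x : BasisPair n r × Param d => G x.2) (θ₀, μs) :=
      ContinuousAt.comp (g := G) (f := fun x : BasisPair n r × Param d => x.2) hGc.continuousAt
        continuousAt_snd
    have := continuousAt_id.prodMk hs
    rw [← hG0]
    exact this
  have tG1 : Tendsto (fun x : BasisPair n r × Param d => (((1 : BasisPair n n), x.2), G x.2))
      (𝓝 (θ₀, μs)) (𝓝 (((1 : BasisPair n n), μs), ωs)) := by
    have hs : ContinuousAt (fun x : BasisPair n r × Param d => G x.2) (θ₀, μs) :=
      ContinuousAt.comp (g := G) (f := fun x : BasisPair n r × Param d => x.2) hGc.continuousAt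
        continuousAt_snd
    have := (continuousAt_const (y := (1 : BasisPair n n))).prodMk continuousAt_snd |>.prodMk hs
    rw [← hG0]
    exact this
  -- Equality of the transfer values transports smoothness of the norm to `θ₀`. If it fails, it
  -- fails nearby along `G`, against interpolation.
  by_cases hT : S.redTransfer θ₀ μs ωs = S.redTransfer (1 : BasisPair n n) μs ωs
  swap
  · refine vac ?_
    have c1 : ContinuousAt (fun y : (BasisPair n r × Param d) × ℝ => S.redTransfer y.1.1 y.1.2 y.2)
        ((θ₀, μs), ωs) :=
      (contDiffAt_redTransfer (k := 0) hS (y₀ := ((θ₀, μs), ωs)) hμs hred).continuousAt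
    have c2 : ContinuousAt (fun y : (BasisPair n n × Param d) × ℝ => S.redTransfer y.1.1 y.1.2 y.2)
        (((1 : BasisPair n n), μs), ωs) :=
      (contDiffAt_redTransfer (k := 0) hS (y₀ := (((1 : BasisPair n n), μs), ωs))
        hμs hdet).continuousAt
    have t1 : Tendsto (fun x : BasisPair n r × Param d => S.redTransfer x.1 x.2 (G x.2))
        (𝓝 (θ₀, μs)) (𝓝 (S.redTransfer θ₀ μs ωs)) := by
      have := c1.tendsto.comp tG
      exact this
    have t2 : Tendsto (fun x : BasisPair n r × Param d =>
        S.redTransfer (1 : BasisPair n n) x.2 (G x.2))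
        (𝓝 (θ₀, μs)) (𝓝 (S.redTransfer (1 : BasisPair n n) μs ωs)) := by
      have := c2.tendsto.comp tG1
      exact this
    have t3 := (t1.sub t2).eventually_ne (sub_ne_zero.2 hT)
    have hne : ∀ᶠ x : BasisPair n r × Param d in 𝓝 (θ₀, μs),
        S.redTransfer x.1 x.2 (G x.2) ≠ S.redTransfer (1 : BasisPair n n) x.2 (G x.2) :=
      t3.mono fun x hx => sub_ne_zero.1 hx
    filter_upwards [hint, hne] with x h1 h2 hc
    exact absurd (h1 hc).transfer_eq h2
  have cΦ : ContDiffAt ℝ 4 (S.redSigma (r := r)) ((θ₀, μs), ωs) :=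
    ParamSystem.contDiffAt_redSigma hS (y₀ := ((θ₀, μs), ωs)) hμs hred (by
      simp only [hT]; exact hn)
  have cΦev : ∀ᶠ x : BasisPair n r × Param d in 𝓝 (θ₀, μs),
      ContDiffAt ℝ 4 (S.redSigma (r := r)) (x, G x.2) :=
    tG.eventually (cΦ.eventually (by simp))
  have hslice : ∀ (x : BasisPair n r × Param d) (ω : ℝ), ContDiffAt ℝ 4 (S.redSigma (r := r)) (x, ω) →
      ContDiffAt ℝ 4 (fun z : Param d × ℝ => S.redSigma ((x.1, z.1), z.2)) (x.2, ω) := by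
    intro x ω hx
    exact ContDiffAt.comp (g := S.redSigma (r := r))
      (f := fun z : Param d × ℝ => ((x.1, z.1), z.2)) (x.2, ω) hx
      ((contDiffAt_const.prodMk contDiffAt_fst).prodMk contDiffAt_snd)
  have hstat : ∀ᶠ x : BasisPair n r × Param d in 𝓝 (θ₀, μs), S.Contains x.1 x.2 (G x.2) →
      HasDerivAt (fun ω => S.redSigma (x, ω)) 0 (G x.2) := by
    filter_upwards [hint, hPk, cΦev] with x h1 h2 h3 hc
    have h4 := hasDerivAt_of_contDiffAt (by simp) (hslice x _ h3)
    rw [(h1 hc).fderiv_eq, h2.fderiv_eq_zero] at h4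
    exact h4
  -- Interpolating bases have `G μ` as a stationary frequency, and a nonzero frequency derivative at
  -- `θ₀` persists nearby.
  by_cases hst : HasDerivAt (fun ω => S.redSigma ((θ₀, μs), ω)) 0 ωs
  swap
  · refine vac ?_
    have hc : ContinuousAt (fun y : (BasisPair n r × Param d) × ℝ =>
        fderiv ℝ (S.redSigma (r := r)) y (0, 1)) ((θ₀, μs), ωs) :=
      ((cΦ.fderiv_right (m := 3) (by norm_num)).clm_apply contDiffAt_const).continuousAt
    have hne : fderiv ℝ (S.redSigma (r := r)) ((θ₀, μs), ωs) (0, 1) ≠ 0 := by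
      intro h
      have := hasDerivAt_of_contDiffAt (by simp) cΦ
      rw [h] at this
      exact hst this
    filter_upwards [hstat, cΦev, tG.eventually (hc.eventually_ne hne)] with x h1 h2 h3 hcon
    exact absurd ((hasDerivAt_of_contDiffAt (by simp) h2).unique (h1 hcon)) h3
  -- If the second derivative is nonnegative at `θ₀`, it exceeds `δ < 0` for all nearby bases.
  by_cases h2 : iteratedDeriv 2 (fun ω => S.redSigma ((θ₀, μs), ω)) ωs < 0
  swap
  · refine vac ?_
    have hc := continuousAt_iteratedDeriv_two cΦ
    have hs : ContinuousAt (fun θ : BasisPair n r => (θ, μs)) θ₀ := by fun_prop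
    have h3 : ∀ᶠ θ in 𝓝 θ₀, δ < iteratedDeriv 2 (fun ω => S.redSigma ((θ, μs), ω)) ωs :=
      hs.tendsto.eventually (hc.eventually_const_lt (hδ.trans_le (not_lt.1 h2)))
    have h4 : ∀ᶠ x : BasisPair n r × Param d in 𝓝 (θ₀, μs),
        δ < iteratedDeriv 2 (fun ω => S.redSigma ((x.1, μs), ω)) ωs :=
      (continuousAt_fst : ContinuousAt Prod.fst (θ₀, μs)).tendsto.eventually h3
    filter_upwards [h4] with x hx _
    exact not_le.2 hx
  -- the main case
  obtain ⟨g, hgc, hg0, hg⟩ := exists_stationary_branch cΦ hst h2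
  set F₁ : BasisPair n r × Param d → ℝ := fun x => S.redSigma (x, g x) with hF₁
  set F₀ : Param d → ℝ := fun μ => S.redSigma (((1 : BasisPair n n), μ), G μ) with hF₀
  have hF₁c : ∀ x, ContDiffAt ℝ 3 g x → ContDiffAt ℝ 4 (S.redSigma (r := r)) (x, g x) →
      ContDiffAt ℝ 3 F₁ x := fun x h3 h4 =>
    ContDiffAt.comp (g := S.redSigma (r := r)) (f := fun x => (x, g x)) x
      (h4.of_le (by norm_num)) (contDiffAt_id.prodMk h3)
  have hF₀c : ∀ μ, S.IsPeakBranchAt G μ → ContDiffAt ℝ 3 F₀ μ := fun μ h =>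
    ContDiffAt.comp (g := S.redSigma (r := n))
      (f := fun μ => (((1 : BasisPair n n), μ), G μ)) μ
      (h.contDiffAt_redSigma.of_le (by norm_num))
      ((contDiffAt_const.prodMk contDiffAt_id).prodMk h.contDiffAt)
  set f : BasisPair n r × Param d → ℝ := fun x => F₁ x - F₀ x.2 with hf
  have hfc : ContDiffAt ℝ 3 f (θ₀, μs) := by
    refine (hF₁c _ hgc (by rw [hg0]; exact cΦ)).sub ?_
    exact ContDiffAt.comp (g := F₀) (f := fun x : BasisPair n r × Param d => x.2) (θ₀, μs)
      (hF₀c μs hG.self_of_nhds) contDiffAt_snd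
  obtain ⟨ζ₀, hζ₀, ε₀, hε₀, hbound⟩ := norm_hessian_le_of_vanishing hfc
  obtain ⟨η₀, hgη, hη₀⟩ := (hg.and self_mem_nhdsWithin).exists
  have hG' : Tendsto G (𝓝 μs) (𝓝 ωs) := by
    rw [← hG0]; exact hGc.continuousAt
  have hGball : ∀ᶠ x : BasisPair n r × Param d in 𝓝 (θ₀, μs), G x.2 ∈ Metric.closedBall ωs η₀ :=
    (continuousAt_snd : ContinuousAt Prod.snd (θ₀, μs)).tendsto.eventually
      (hG'.eventually_mem (Metric.closedBall_mem_nhds ωs hη₀))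
  -- Since `U` is chosen before `ηω`, `g(θ, μs)` need not be within `ηω` of `ωs` for every `θ ∈ U`.
  -- The range of the branch is controlled by its value `G μ` at the interpolation point and this
  -- Lipschitz bound in the parameter.
  obtain ⟨L, t, ht, hL⟩ := (hgc.of_le (by norm_num) : ContDiffAt ℝ 1 g (θ₀, μs)).exists_lipschitzOnWith
  obtain ⟨ε, hε, hball⟩ := exists_ball_of_eventually
    ((hgη.and ((hint.and (hPk.eventually_nhds.and (hstat.and cΦev))).and hGball)).and ht)
  replace hL : ∀ θ ∈ Metric.ball θ₀ ε, ∀ ν ∈ Metric.ball μs ε, ∀ ν' ∈ Metric.ball μs ε,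
      dist (g (θ, ν)) (g (θ, ν')) ≤ L * dist ν ν' := by
    intro θ hθ ν hν ν' hν'
    refine (hL.dist_le_mul _ (hball θ hθ ν hν).2 _ (hball θ hθ ν' hν').2).trans_eq ?_
    rw [Prod.dist_eq, dist_self, max_eq_right dist_nonneg]
  replace hball := fun θ hθ ν hν => (hball θ hθ ν hν).1
  refine ⟨Metric.ball θ₀ ε ∩ Metric.ball θ₀ ε₀,
    inter_mem (Metric.ball_mem_nhds θ₀ hε) (Metric.ball_mem_nhds θ₀ hε₀), ?_⟩
  filter_upwards [eventually_ge_atTop ζ₀] with ζ hζ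
  filter_upwards [eventually_lt_nhdsGT hη₀] with ηω hηω
  -- Points of the ball are at most `2ημ` from `μ`, so `ημ < ηω / (4(L+1))` limits the variation of
  -- `g` to `ηω / 2`. The other half is reserved for the distance from `G μ` to `ωs`.
  have hL0 : (0 : ℝ) < 4 * (L + 1) := by positivity
  filter_upwards [eventually_lt_nhdsGT hε, eventually_lt_nhdsGT (div_pos hηω.1 hL0)] with ημ hημ hημ'
  -- Adjacent points lie within `ρ + 2h < 3ρ` of `μs`, hence the third of `ημ`.
  have hmin : 0 < min (ημ / 3) ε₀ := lt_min (by linarith [hημ.1]) hε₀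
  obtain ⟨ε₁, hε₁, hGε⟩ := Metric.mem_nhds_iff.1
    (hG'.eventually_mem (Metric.closedBall_mem_nhds ωs (half_pos hηω.1)))
  filter_upwards [eventually_lt_nhdsGT hmin, eventually_lt_nhdsGT hε₁] with ρ hρ hρε₁
  have hρ1 : ρ < ημ / 3 := hρ.2.trans_le (min_le_left _ _)
  have hρ2 : ρ < ε₀ := hρ.2.trans_le (min_le_right _ _)
  rintro θ ⟨hθ, hθ₀⟩
  intro μ hμ h h0 hh s hs hc hcs _
  have hcb : ∀ ν ∈ Metric.closedBall μs ημ, ν ∈ Metric.ball μs ε := fun ν hν =>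
    Metric.closedBall_subset_ball hημ.2 hν
  have hμ3 : μ ∈ Metric.ball μs ημ := Metric.ball_subset_ball (by linarith [hρ.1]) hμ
  have hμε : μ ∈ Metric.ball μs ε := Metric.ball_subset_ball hημ.2.le hμ3
  have hgG : ∀ ν ∈ Metric.ball μs ε, S.Contains θ ν (G ν) → g (θ, ν) = G ν ∧ f (θ, ν) = 0 := by
    intro ν hν hcν
    obtain ⟨hA, ⟨hB1, _, hB3, _⟩, hC⟩ := hball θ hθ ν hν
    have e := (hA.2.2.2.2.1 (G ν) hC (hB3 hcν)).symm
    refine ⟨e, ?_⟩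
    have := (hB1 hcν).sigma_eq
    simp only [hf, hF₁, hF₀, e]
    exact sub_eq_zero.2 this
  obtain ⟨hA, ⟨hB1, hB2, hB3, hB4⟩, hC⟩ := hball θ hθ μ hμε
  have hB2' : ∀ᶠ ν in 𝓝 μ, S.IsPeakBranchAt G ν := by
    have hc : ContinuousAt (fun ν : Param d => (θ, ν)) μ := by fun_prop
    exact hc.tendsto.eventually hB2
  have hPkμ : S.IsPeakBranchAt G μ := hB2'.self_of_nhds
  have hgμ := (hgG μ hμε hc).1
  have c1 : ContDiffAt ℝ 3 (fun ν => F₁ (θ, ν)) μ :=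
    ContDiffAt.comp (g := F₁) (f := fun ν : Param d => (θ, ν)) μ (hF₁c _ hA.2.1 hA.2.2.1)
      (contDiffAt_const.prodMk contDiffAt_id)
  have c0 := hF₀c μ hPkμ
  -- By the envelope theorem both gradients are partial gradients in `μ` at the same frequency, and
  -- these agree by interpolation.
  have hfd : HasFDerivAt (fun ν => f (θ, ν)) (0 : Param d →L[ℝ] ℝ) μ := by
    have hgd : DifferentiableAt ℝ (fun ν => g (θ, ν)) μ :=
      (ContDiffAt.comp (g := g) (f := fun ν : Param d => (θ, ν)) μ hA.2.1
        (contDiffAt_const.prodMk contDiffAt_id)).differentiableAt (by simp)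
    have hfe := (hB1 hc).fderiv_eq
    have hz := hPkμ.fderiv_eq_zero
    have d1 := hasFDerivAt_comp_of_stationary (w := fun ν => g (θ, ν))
      (σ := fun z : Param d × ℝ => S.redSigma ((θ, z.1), z.2)) (x := μ)
      ((hslice (θ, μ) (g (θ, μ)) hA.2.2.1).differentiableAt (by simp)) hgd (by
        simp only [hgμ]; rw [hfe]; exact hz)
    have hc1 : ContDiffAt ℝ 4 (fun z : Param d × ℝ => S.redSigma (((1 : BasisPair n n), z.1), z.2))
        (μ, G μ) :=
      ContDiffAt.comp (g := S.redSigma (r := n)) (μ, G μ) hPkμ.contDiffAt_redSigma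
        ((contDiffAt_const.prodMk contDiffAt_fst).prodMk contDiffAt_snd)
    have d0 := hasFDerivAt_comp_of_stationary (w := G)
      (σ := fun z : Param d × ℝ => S.redSigma (((1 : BasisPair n n), z.1), z.2)) (x := μ)
      (hc1.differentiableAt (by simp)) (hPkμ.contDiffAt.differentiableAt (by simp)) hz
    have d2 := d1.sub d0
    simp only [hgμ] at d2
    rw [hfe, sub_self] at d2
    exact d2
  have hH := hbound θ hθ₀ μ (Metric.ball_subset_ball hρ2.le hμ) h h0 (hh.trans hρ2) s hs
    (hgG μ hμε hc).2 hfd fun a q haq => by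
      refine (hgG _ (hcb _ ?_) (hcs a q haq)).2
      rw [Metric.mem_closedBall, dist_eq_norm]
      rw [Metric.mem_ball, dist_eq_norm] at hμ
      have h1 : ‖s a q • eDir a q‖ ≤ h * 2 := by
        rw [norm_smul, Real.norm_eq_abs, hs]
        exact mul_le_mul_of_nonneg_left (norm_eDir_le a q) h0.le
      calc ‖μ + s a q • eDir a q - μs‖ = ‖(μ - μs) + s a q • eDir a q‖ := by congr 1; abel
        _ ≤ _ := norm_add_le _ _
        _ ≤ ημ := by linarith
  refine ⟨fun ν => g (θ, ν), ⟨?_, ?_, ?_, hgμ, ?_⟩, ?_, c1.of_le (by norm_num), ?_⟩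
  · intro ν hν
    exact (ContDiffAt.comp (g := g) (f := fun ν : Param d => (θ, ν)) ν
      (hball θ hθ ν (hcb ν hν)).1.2.1
      (contDiffAt_const.prodMk contDiffAt_id)).continuousAt.continuousWithinAt
  · intro ν hν
    have h1 := hL θ hθ ν (hcb ν hν) μ hμε
    have h2 : dist (G μ) ωs ≤ ηω / 2 := hGε (Metric.ball_subset_ball hρε₁.2.le hμ)
    have h3 : dist ν μ ≤ 2 * ημ := by
      have h4 := dist_triangle_right ν μ μs
      rw [Metric.mem_closedBall] at hν
      rw [Metric.mem_ball] at hμ3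
      linarith
    have h5 : (L : ℝ) * dist ν μ ≤ (L + 1) * (2 * ημ) := by
      gcongr
      linarith
    have h6 : ημ * (4 * (L + 1)) < ηω := (lt_div_iff₀ hL0).1 hημ'.2
    rw [hgμ] at h1
    rw [Metric.mem_closedBall]
    have h7 := dist_triangle (g (θ, ν)) (G μ) ωs
    nlinarith
  · intro ν hν
    exact (ContDiffAt.comp (g := g) (f := fun ν : Param d => (θ, ν)) ν
      (hball θ hθ ν (hcb ν (interior_subset hν))).1.2.1
      (contDiffAt_const.prodMk contDiffAt_id)).contDiffWithinAt
  · intro ν hν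
    exact (hball θ hθ ν (hcb ν hν)).1.2.2.2.1
  · intro w' hw' ν hν
    exact (hball θ hθ ν (hcb ν hν)).1.2.2.2.2.1 (w' ν)
      (Metric.closedBall_subset_closedBall hηω.2.le (hw'.mapsTo hν)) (hw'.stationary ν hν)
  · have e0 : hessian (fun ν => (S.full ν).hinfNorm) μ = hessian F₀ μ :=
      hessian_congr (hB2'.mono fun ν hν => hν.hinfNorm_eq)
    have e1 := hessian_sub (c1.of_le (by norm_num) : ContDiffAt ℝ 2 _ μ)
      (c0.of_le (by norm_num) : ContDiffAt ℝ 2 _ μ)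
    rw [e0, norm_sub_rev]
    calc _ = ‖hessian (fun ν => f (θ, ν)) μ‖ := congrArg norm e1.symm
      _ ≤ ζ₀ * h := hH
      _ ≤ ζ * h := by gcongr

/-- The orthonormal bases whose reduced pencil is bounded below by `β`. -/
def admissibleBases (S : ParamSystem d n m p) (r : ℕ) (μs : Param d) (ωs β : ℝ) :
    Set (BasisPair n r) :=
  {θ | θ.1ᴴ * θ.1 = 1 ∧ θ.2ᴴ * θ.2 = 1 ∧ ∀ x : EuclideanSpace ℂ (Fin r),
    β * ‖x‖ ≤ ‖Matrix.toEuclideanLin (S.redPencil θ μs ωs) x‖}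

/-- Stating the lower bound as an inequality for every vector makes closedness immediate, without
continuity of singular values. Orthonormality gives boundedness. -/
theorem isCompact_admissibleBases (S : ParamSystem d n m p) (r : ℕ) (μs : Param d) (ωs β : ℝ) :
    IsCompact (S.admissibleBases r μs ωs β) := by
  have : ProperSpace (BasisPair n r) := FiniteDimensional.proper ℂ _
  refine Metric.isCompact_of_isClosed_isBounded ?_ ?_
  · refine IsClosed.and ?_ (IsClosed.and ?_ ?_)
    · exact isClosed_eq (by fun_prop) continuous_const
    · exact isClosed_eq (by fun_prop) continuous_const
    · simp only [ofPred_forall]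
      refine isClosed_iInter fun x => isClosed_le continuous_const ?_
      let L : Matrix (Fin r) (Fin r) ℂ →ₗ[ℂ] EuclideanSpace ℂ (Fin r) :=
        (LinearMap.applyₗ x).comp Matrix.toEuclideanLin.toLinearMap
      have hL : Continuous L := LinearMap.continuous_of_finiteDimensional L
      have hP : Continuous (fun θ : BasisPair n r => S.redPencil θ μs ωs) := by
        unfold redPencil
        fun_prop
      exact (hL.comp hP).norm
  · have key : ∀ V : Matrix (Fin n) (Fin r) ℂ, Vᴴ * V = 1 →
        ‖V‖ ≤ ‖(1 : Matrix (Fin r) (Fin r) ℂ)‖ + 1 := by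
      intro V hV
      have := Matrix.l2_opNorm_conjTranspose_mul_self V
      rw [hV] at this
      nlinarith [norm_nonneg V]
    refine isBounded_iff_forall_norm_le.2 ⟨‖(1 : Matrix (Fin r) (Fin r) ℂ)‖ + 1, fun θ hθ => ?_⟩
    exact max_le (key _ hθ.1) (key _ hθ.2.1)

/-- Compactness reduces to finitely many neighbourhoods. The nested `∀ᶠ` quantifiers are closed
under finite intersections, so the constants of different neighbourhoods can be reconciled without
monotonicity in each of them. -/
theorem eventually_forall_hasHessianBound {μs : Param d} {ωs β δ : ℝ} {G : Param d → ℝ}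
    (h : ∀ θ₀ ∈ S.admissibleBases r μs ωs β,
      ∃ U ∈ 𝓝 θ₀, ∀ᶠ ζ in atTop, ∀ᶠ ηω in 𝓝[>] (0 : ℝ), ∀ᶠ ημ in 𝓝[>] (0 : ℝ), ∀ᶠ ρ in 𝓝[>] (0 : ℝ),
        ∀ θ ∈ U, S.HasHessianBound μs ωs δ G ζ ηω ημ ρ θ) :
    ∀ᶠ ζ in atTop, ∀ᶠ ηω in 𝓝[>] (0 : ℝ), ∀ᶠ ημ in 𝓝[>] (0 : ℝ), ∀ᶠ ρ in 𝓝[>] (0 : ℝ),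
      ∀ θ ∈ S.admissibleBases r μs ωs β, S.HasHessianBound μs ωs δ G ζ ηω ημ ρ θ := by
  refine (S.isCompact_admissibleBases r μs ωs β).induction_on
    (p := fun K => ∀ᶠ ζ in atTop, ∀ᶠ ηω in 𝓝[>] (0 : ℝ), ∀ᶠ ημ in 𝓝[>] (0 : ℝ),
      ∀ᶠ ρ in 𝓝[>] (0 : ℝ), ∀ θ ∈ K, S.HasHessianBound μs ωs δ G ζ ηω ημ ρ θ) ?_ ?_ ?_ ?_
  · simp
  · intro K K' hKK' hK'
    filter_upwards [hK'] with ζ h1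
    filter_upwards [h1] with ηω h2
    filter_upwards [h2] with ημ h3
    filter_upwards [h3] with ρ h4 θ hθ
    exact h4 θ (hKK' hθ)
  · intro K K' hK hK'
    filter_upwards [hK, hK'] with ζ h1 h1'
    filter_upwards [h1, h1'] with ηω h2 h2'
    filter_upwards [h2, h2'] with ημ h3 h3'
    filter_upwards [h3, h3'] with ρ h4 h4' θ hθ
    exact hθ.elim (h4 θ) (h4' θ)
  · intro θ₀ hθ₀
    obtain ⟨U, hU, hU'⟩ := h θ₀ hθ₀
    exact ⟨U, mem_nhdsWithin_of_mem_nhds hU, hU'⟩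

end ParamSystem

end HinfMin

namespace HinfMin

/-! ### Containment properties of the runs -/

namespace ParamSystem

variable {d n m p : ℕ} {S : ParamSystem d n m p}

theorem contDiffAt_hinfNorm {G : Param d → ℝ} {μ : Param d}
    (h : ∀ᶠ ν in 𝓝 μ, S.IsPeakBranchAt G ν) :
    ContDiffAt ℝ 3 (fun ν => (S.full ν).hinfNorm) μ := by
  have h0 := h.self_of_nhds
  refine ContDiffAt.congr_of_eventuallyEq (ContDiffAt.comp (g := S.redSigma (r := n))
    (f := fun μ => (((1 : BasisPair n n), μ), G μ)) μ
    (h0.contDiffAt_redSigma.of_le (by norm_num))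
    ((contDiffAt_const.prodMk contDiffAt_id).prodMk h0.contDiffAt)) ?_
  exact h.mono fun ν hν => hν.hinfNorm_eq

end ParamSystem

variable {d n m p : ℕ} {S : ParamSystem d n m p} {Ω Ωc : Set (Param d)} {R : Run d n}

theorem IsBasicRun.contains {k : ℕ} (h : IsBasicRun S Ωc k R) {j : ℕ} (hj : j < k) :
    S.Contains (R.V (j + 1), R.W (j + 1)) (R.μ (j + 1)) (R.ω (j + 1)) :=
  ⟨by rw [h.expandV j hj]; exact le_sup_right, by rw [h.expandW j hj]; exact le_sup_right⟩

theorem IsBasicRun.contains_previous {k : ℕ} (h : IsBasicRun S Ωc k R) {j : ℕ} (hj : j + 1 < k) :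
    S.Contains (R.V (j + 2), R.W (j + 2)) (R.μ (j + 1)) (R.ω (j + 1)) := by
  obtain ⟨h1, h2⟩ := h.contains (j := j) (by omega)
  exact ⟨by rw [h.expandV (j + 1) hj]; exact h1.trans le_sup_left,
    by rw [h.expandW (j + 1) hj]; exact h2.trans le_sup_left⟩

theorem IsExtendedRun.contains {k : ℕ} (h : IsExtendedRun S Ω Ωc k R) {j : ℕ} (hj : j < k) :
    S.Contains (R.V (j + 1), R.W (j + 1)) (R.μ (j + 1)) (R.ω (j + 1)) :=
  ⟨by rw [h.expandV j hj]; exact le_sup_right.trans le_sup_left,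
    by rw [h.expandW j hj]; exact le_sup_right.trans le_sup_left⟩

theorem IsExtendedRun.contains_adjacent {k : ℕ} (h : IsExtendedRun S Ω Ωc k R) {j : ℕ} (hj : j < k)
    (h1 : 1 ≤ j) {r q : Fin d} (hrq : r ≤ q) :
    S.Contains (R.V (j + 1), R.W (j + 1)) (R.adjacent j r q) (R.ωAdj (j + 1) r q) := by
  constructor
  · rw [h.expandV j hj]
    exact le_sup_of_le_right (le_iSup_of_le h1 (le_iSup_of_le r (le_iSup_of_le q
      (le_iSup_of_le hrq le_rfl))))
  · rw [h.expandW j hj]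
    exact le_sup_of_le_right (le_iSup_of_le h1 (le_iSup_of_le r (le_iSup_of_le q
      (le_iSup_of_le hrq le_rfl))))

/-- The last bases of a run contain the expansions at the last iterate and at a family of adjacent
points in the directions `eDir r q`. -/
theorem exists_adjacent_of_run {G : Param d → ℝ} {ρ : ℝ} {μs : Param d}
    (hG : ∀ μ ∈ Metric.ball μs ρ, ∀ ω, (S.full μ).IsPeak ω → ω = G μ) {k : ℕ} (hk : 2 ≤ k)
    (hRun : (d = 1 ∧ IsBasicRun S Ωc k R) ∨ IsExtendedRun S Ω Ωc k R)
    (h1 : R.μ k ∈ Metric.ball μs (ρ / 5)) (h2 : R.μ (k - 1) ∈ Metric.ball μs (ρ / 5)) :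
    R.Orthonormal k ∧ R.ω k = G (R.μ k) ∧ S.Contains (R.V k, R.W k) (R.μ k) (G (R.μ k)) ∧
      ∃ s : Fin d → Fin d → ℝ, (∀ r q, |s r q| = ‖R.μ k - R.μ (k - 1)‖) ∧
        ∀ r q, r ≤ q → S.Contains (R.V k, R.W k) (R.μ k + s r q • eDir r q)
          (G (R.μ k + s r q • eDir r q)) := by
  obtain ⟨j, rfl⟩ : ∃ j, k = j + 2 := ⟨k - 2, by omega⟩
  have hpred : j + 2 - 1 = j + 1 := rfl
  rw [hpred] at h2 ⊢
  have hρ : 0 < ρ := by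
    have := Metric.pos_of_mem_ball h1
    linarith
  have hb : ∀ μ ∈ Metric.ball μs (ρ / 5), μ ∈ Metric.ball μs ρ := fun μ hμ =>
    Metric.ball_subset_ball (by linarith) hμ
  rcases hRun with ⟨rfl, hR⟩ | hR
  · have hω := hG _ (hb _ h1) _ (hR.iterate (j + 1) (by omega)).peak
    have hω' := hG _ (hb _ h2) _ (hR.iterate j (by omega)).peak
    -- With one parameter the signed step leads from the last iterate back to the previous one,
    -- whose expansion is still contained in the bases.
    refine ⟨hR.orthonormal, hω, ?_, fun _ _ => R.μ (j + 1) 0 - R.μ (j + 2) 0, ?_, ?_⟩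
    · rw [← hω]; exact hR.contains (by omega)
    · intro r q
      rw [EuclideanSpace.norm_eq, abs_sub_comm]
      simp [Real.sqrt_sq_eq_abs]
    · intro r q _
      have hpt : R.μ (j + 2) + (R.μ (j + 1) 0 - R.μ (j + 2) 0) • eDir r q = R.μ (j + 1) := by
        ext i
        have hi := Subsingleton.elim i 0
        have hr := Subsingleton.elim r q
        have hq := Subsingleton.elim q 0
        subst hi hr hq
        simp [eDir]
      rw [hpt, ← hω']
      exact hR.contains_previous (by omega)
  · have hω := hG _ (hb _ h1) _ (hR.iterate (j + 1) (by omega)).peak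
    refine ⟨hR.orthonormal, hω, ?_, fun _ _ => ‖R.μ (j + 2) - R.μ (j + 1)‖, fun _ _ => abs_norm _, ?_⟩
    · rw [← hω]; exact hR.contains (by omega)
    · intro r q hrq
      have hc := hR.contains_adjacent (j := j + 1) (by omega) (by omega) hrq
      have hpk := hR.adjacent_peak (j + 1) (by omega) (by omega) r q hrq
      -- The fraction `1/5` is exact for this estimate: the step has length below `2 · 2ρ/5`, and
      -- `ρ/5 + 4ρ/5 = ρ`.
      have hmem : R.adjacent (j + 1) r q ∈ Metric.ball μs ρ := by
        rw [Metric.mem_ball, dist_eq_norm] at h1 h2 ⊢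
        have e1 : ‖R.μ (j + 2) - R.μ (j + 1)‖ < 2 * (ρ / 5) := by
          have := norm_sub_le (R.μ (j + 2) - μs) (R.μ (j + 1) - μs)
          rw [sub_sub_sub_cancel_right] at this
          linarith
        have e2 : ‖‖R.μ (j + 2) - R.μ (j + 1)‖ • eDir r q‖ ≤
            ‖R.μ (j + 2) - R.μ (j + 1)‖ * 2 := by
          rw [norm_smul, norm_norm]
          exact mul_le_mul_of_nonneg_left (norm_eDir_le r q) (norm_nonneg _)
        have e3 : R.adjacent (j + 1) r q - μs =
            (R.μ (j + 2) - μs) + ‖R.μ (j + 2) - R.μ (j + 1)‖ • eDir r q := by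
          unfold Run.adjacent; abel
        rw [e3]
        refine (norm_add_le _ _).trans_lt ?_
        linarith
      have := hG _ hmem _ hpk
      rw [this] at hc
      exact hc

end HinfMin

/-! ### Choice of the common constants and conclusion -/

theorem lemma3p6 {d n m p : ℕ} (S : HinfMin.ParamSystem d n m p)
    -- the parameter domain, the coefficients, the admissible set
    (Ω : Set (HinfMin.Param d)) (hΩopen : IsOpen Ω) (hΩbdd : Bornology.IsBounded Ω)
    (hS : S.IsAnalytic Ω)
    (Ωc : Set (HinfMin.Param d)) (hΩc : IsCompact Ωc) (hsub : Ωc ⊆ Ω)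
    (hHinf : ∀ μ ∈ Ωc, (S.full μ).IsHinf)
    -- the minimizer
    (μs : HinfMin.Param d) (hμs : μs ∈ Ωc)
    (hmin : IsLocalMinOn (fun μ => (S.full μ).hinfNorm) Ωc μs)
    (hnear : ∀ᶠ μ in 𝓝 μs, (S.full μ).IsHinf)
    (hcont : ∀ ω : OnePoint ℝ, ContinuousAt
      (fun x : HinfMin.Param d × OnePoint ℝ => (S.full x.1).sigmaExt x.2) (μs, ω))
    -- the smoothness assumption
    (ωs : ℝ)
    (hmax : ∀ ω : OnePoint ℝ, ω ≠ (ωs : OnePoint ℝ) →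
      (S.full μs).sigmaExt ω < (S.full μs).sigma ωs)
    (hpos : 0 < (S.full μs).sigma ωs)
    (hsimple : HinfMin.sigmaSecond ((S.full μs).H (Complex.I * ωs)) < (S.full μs).sigma ωs)
    -- the remaining assumptions on the full problem
    (δ β : ℝ) (hδ : δ < 0) (hβ : 0 < β)
    (hωω : iteratedDeriv 2 (S.full μs).sigma ωs ≤ δ)
    (hD : β ≤ HinfMin.sigmaMin ((S.full μs).D (Complex.I * ωs)))
    (hHess : IsUnit (HinfMin.hessian (fun μ => (S.full μ).hinfNorm) μs))
    -- a family of runs with `k` steps, in which `μ^(k), μ^(k-1) → μs` as `μ^(1) → μs`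
    (k : ℕ) (hk : 2 ≤ k) (𝓡 : Set (HinfMin.Run d n))
    (hRuns : (d = 1 ∧ ∀ R ∈ 𝓡, HinfMin.IsBasicRun S Ωc k R) ∨
      (∀ R ∈ 𝓡, HinfMin.IsExtendedRun S Ω Ωc k R))
    (hconv : ∀ j ∈ ({k - 1, k} : Set ℕ),
      Tendsto (fun R : HinfMin.Run d n => R.μ j)
        (comap (fun R : HinfMin.Run d n => R.μ 1) (𝓝 μs) ⊓ 𝓟 𝓡) (𝓝 μs)) :
    ∃ ζ > 0, ∃ ρ > 0, ∃ ημ > 0, ∃ ηω > 0, Metric.closedBall μs ημ ⊆ Ω ∧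
      ∀ R ∈ 𝓡, ‖R.μ 1 - μs‖ < ρ → R.μ k ≠ R.μ (k - 1) →
        iteratedDeriv 2 (S.reduced (R.V k) (R.W k) μs).sigma ωs ≤ δ →
        β ≤ HinfMin.sigmaMin ((S.reduced (R.V k) (R.W k) μs).D (Complex.I * ωs)) →
        R.μ k ∈ interior (Metric.closedBall μs ημ) ∧
        ∃ w : HinfMin.Param d → ℝ,
          -- `w` is the frequency function of the reduced problem, and it is unique
          HinfMin.IsFrequencyBranch (fun μ => (S.reduced (R.V k) (R.W k) μ).sigma)
            μs ωs ημ ηω (R.μ k) (R.ω k) w ∧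
          (∀ w' : HinfMin.Param d → ℝ,
            HinfMin.IsFrequencyBranch (fun μ => (S.reduced (R.V k) (R.W k) μ).sigma)
              μs ωs ημ ηω (R.μ k) (R.ω k) w' → EqOn w' w (Metric.closedBall μs ημ)) ∧
          -- both functions are twice continuously differentiable at `μ^(k)`
          ContDiffAt ℝ 2 (fun μ => (S.full μ).hinfNorm) (R.μ k) ∧
          ContDiffAt ℝ 2 (fun μ => (S.reduced (R.V k) (R.W k) μ).sigma (w μ)) (R.μ k) ∧
          -- (i)
          ‖HinfMin.hessian (fun μ => (S.full μ).hinfNorm) (R.μ k) -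
            HinfMin.hessian (fun μ => (S.reduced (R.V k) (R.W k) μ).sigma (w μ)) (R.μ k)‖
            ≤ ζ * ‖R.μ k - R.μ (k - 1)‖ ∧
          -- (ii)
          IsUnit (HinfMin.hessian (fun μ => (S.full μ).hinfNorm) (R.μ k)) ∧
          IsUnit (HinfMin.hessian
            (fun μ => (S.reduced (R.V k) (R.W k) μ).sigma (w μ)) (R.μ k)) ∧
          -- (iii)
          ‖(HinfMin.hessian (fun μ => (S.full μ).hinfNorm) (R.μ k))⁻¹ -
            (HinfMin.hessian
              (fun μ => (S.reduced (R.V k) (R.W k) μ).sigma (w μ)) (R.μ k))⁻¹‖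
            ≤ ζ * ‖R.μ k - R.μ (k - 1)‖ := by
  have hμΩ : μs ∈ Ω := hsub hμs
  have hdetp : (S.pencil μs ωs).det ≠ 0 :=
    HinfMin.det_ne_zero_of_forall_mul_norm_le hβ fun x =>
      (mul_le_mul_of_nonneg_right hD (norm_nonneg x)).trans (HinfMin.sigmaMin_mul_norm_le _ x)
  have hdet : (S.redPencil (1 : HinfMin.BasisPair n n) μs ωs).det ≠ 0 := by
    rwa [HinfMin.ParamSystem.redPencil_one]
  have hH : (S.full μs).H (Complex.I * ωs) =
      S.redTransfer (1 : HinfMin.BasisPair n n) μs ωs := by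
    have h := S.reduced_H hdet
    rwa [Prod.fst_one, Prod.snd_one, S.reduced_one] at h
  have hσ : (S.full μs).sigma ωs = ‖S.redTransfer (1 : HinfMin.BasisPair n n) μs ωs‖ := by
    rw [HinfMin.Descriptor.sigma_eq_norm, hH]
  rw [hσ] at hpos
  rw [hH, hσ] at hsimple
  have hn := HinfMin.contDiffAt_norm_of_simple hpos hsimple
  obtain ⟨G, hG0, hGc, hG⟩ := HinfMin.ParamSystem.exists_peakBranch hS hμΩ hnear hcont hmax
    (hωω.trans_lt hδ) hdet hn
  -- The reduced dimension may vary between runs but is at most `n`. Intersecting over this finite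
  -- range at each quantifier level gives constants valid for all dimensions.
  have hbd : ∀ r ∈ Finset.range (n + 1),
      ∀ᶠ ζ in atTop, ∀ᶠ ηω in 𝓝[>] (0 : ℝ), ∀ᶠ ημ in 𝓝[>] (0 : ℝ), ∀ᶠ ρ in 𝓝[>] (0 : ℝ),
        ∀ θ ∈ S.admissibleBases r μs ωs β, S.HasHessianBound μs ωs δ G ζ ηω ημ ρ θ := by
    intro r _
    refine HinfMin.ParamSystem.eventually_forall_hasHessianBound fun θ₀ hθ₀ => ?_
    exact HinfMin.ParamSystem.eventually_hasHessianBound hS hΩopen hμΩ hδ hG0 hGc hG hdet hpos hn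
      (HinfMin.det_ne_zero_of_forall_mul_norm_le hβ hθ₀.2.2)
  rw [← Filter.eventually_all_finset] at hbd
  obtain ⟨ζ, hζ0, hζ⟩ := ((eventually_gt_atTop (0 : ℝ)).and hbd).exists
  rw [← Filter.eventually_all_finset] at hζ
  obtain ⟨ηω, hηω, hη⟩ := ((eventually_mem_nhdsWithin (a := (0 : ℝ)) (s := Ioi 0)).and hζ).exists
  rw [← Filter.eventually_all_finset] at hη
  have hF : ContDiffAt ℝ 3 (fun μ => (S.full μ).hinfNorm) μs :=
    HinfMin.ParamSystem.contDiffAt_hinfNorm hG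
  obtain ⟨K, hK0, hK⟩ := HinfMin.exists_norm_inv_le hHess
  obtain ⟨ε, hε, hKε⟩ := Metric.mem_nhds_iff.1 hK
  -- The full Hessian is kept within `ε / 2` of its value at `μs`. The other half absorbs the error
  -- `ζ h` of the reduced Hessian, so both lie where inverses exist and are bounded by `K`.
  obtain ⟨τ, hτ, hball⟩ := Metric.mem_nhds_iff.1 ((hΩopen.eventually_mem hμΩ).and
    (hG.eventually_nhds.and ((HinfMin.continuousAt_hessian hF).eventually_mem
      (Metric.ball_mem_nhds _ (half_pos hε)))))
  obtain ⟨ημ, hημ, hη'⟩ := ((HinfMin.ParamSystem.eventually_lt_nhdsGT hτ).and hη).exists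
  rw [← Filter.eventually_all_finset] at hη'
  have hc0 : 0 < min (min ημ τ) (ε / (2 * ζ)) := lt_min (lt_min hημ.1 hτ) (by positivity)
  obtain ⟨ρ₁, hρ₁, hB⟩ := ((HinfMin.ParamSystem.eventually_lt_nhdsGT hc0).and hη').exists
  have hρη : ρ₁ < ημ := hρ₁.2.trans_le ((min_le_left _ _).trans (min_le_left _ _))
  have hρτ : ρ₁ < τ := hρ₁.2.trans_le ((min_le_left _ _).trans (min_le_right _ _))
  have hρε : ρ₁ * (2 * ζ) < ε := (lt_div_iff₀ (by positivity)).1 (hρ₁.2.trans_le (min_le_right _ _))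
  have hpk : ∀ μ ∈ Metric.ball μs ρ₁, ∀ ω, (S.full μ).IsPeak ω → ω = G μ := fun μ hμ =>
    (hball (Metric.ball_subset_ball hρτ.le hμ)).2.1.self_of_nhds.eq_of_isPeak
  have hev : ∀ j ∈ ({k - 1, k} : Set ℕ), ∃ ρ > 0, ∀ R ∈ 𝓡, ‖R.μ 1 - μs‖ < ρ →
      R.μ j ∈ Metric.ball μs (ρ₁ / 5) := by
    intro j hj
    have h := (hconv j hj).eventually_mem (Metric.ball_mem_nhds μs (by linarith [hρ₁.1] : 0 < ρ₁ / 5))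
    rw [eventually_inf_principal, eventually_comap] at h
    obtain ⟨ρ, hρ, hρ'⟩ := Metric.eventually_nhds_iff.1 h
    exact ⟨ρ, hρ, fun R hR h1 => hρ' (by rwa [dist_eq_norm]) R rfl hR⟩
  obtain ⟨ρa, hρa, hRa⟩ := hev (k - 1) (by simp)
  obtain ⟨ρb, hρb, hRb⟩ := hev k (by simp)
  -- `K * ζ * K` comes from `A⁻¹ - B⁻¹ = A⁻¹ (B - A) B⁻¹`; the maximum serves both estimates.
  have hζ' : ζ ≤ max ζ (K * ζ * K) := le_max_left _ _
  refine ⟨max ζ (K * ζ * K), lt_max_of_lt_left hζ0, min ρa ρb, lt_min hρa hρb, ημ, hημ.1, ηω, hηω,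
    fun μ hμ => (hball (Metric.closedBall_subset_ball hημ.2 hμ)).1, ?_⟩
  intro R hR hR1 hne hdd hsm
  have hμk := hRb R hR (hR1.trans_le (min_le_right _ _))
  have hμk' := hRa R hR (hR1.trans_le (min_le_left _ _))
  have hμkρ : R.μ k ∈ Metric.ball μs ρ₁ := Metric.ball_subset_ball (by linarith [hρ₁.1]) hμk
  obtain ⟨horth, hω, hcon, s, hs, hadj⟩ := HinfMin.exists_adjacent_of_run (R := R) (Ω := Ω) (Ωc := Ωc)
    hpk hk (hRuns.imp (fun h => ⟨h.1, h.2 R hR⟩) fun h => h R hR) hμk hμk'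
  set h := ‖R.μ k - R.μ (k - 1)‖ with hh
  have h0 : 0 < h := norm_pos_iff.2 (sub_ne_zero.2 hne)
  have hlt : h < ρ₁ := by
    rw [Metric.mem_ball, dist_eq_norm] at hμk hμk'
    have := norm_sub_le (R.μ k - μs) (R.μ (k - 1) - μs)
    rw [sub_sub_sub_cancel_right] at this
    linarith [hρ₁.1]
  obtain ⟨hV, hW⟩ := horth k le_rfl
  have hadm : ((R.V k, R.W k) : HinfMin.BasisPair n (R.dim k)) ∈
      S.admissibleBases (R.dim k) μs ωs β := by
    refine ⟨hV, hW, fun x => ?_⟩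
    rw [S.reduced_D] at hsm
    exact (mul_le_mul_of_nonneg_right hsm (norm_nonneg x)).trans (HinfMin.sigmaMin_mul_norm_le _ x)
  have hdim : R.dim k ∈ Finset.range (n + 1) :=
    Finset.mem_range_succ_iff.2 (HinfMin.card_le_of_conjTranspose_mul_self_eq_one hV)
  obtain ⟨w, hw1, hw2, hw3, hw4⟩ := hB (R.dim k) hdim _ hadm (R.μ k) hμkρ h h0 hlt s hs hcon hadj hdd
  obtain ⟨-, hpkb, hAε⟩ := hball (Metric.ball_subset_ball hρτ.le hμkρ)
  have hA := hKε (Metric.ball_subset_ball (by linarith) hAε)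
  have hBε : HinfMin.hessian (fun μ => (S.reduced (R.V k) (R.W k) μ).sigma (w μ)) (R.μ k) ∈
      Metric.ball (HinfMin.hessian (fun μ => (S.full μ).hinfNorm) μs) ε := by
    have hd : dist (HinfMin.hessian (fun μ => (S.reduced (R.V k) (R.W k) μ).sigma (w μ)) (R.μ k))
        (HinfMin.hessian (fun μ => (S.full μ).hinfNorm) (R.μ k)) ≤ ζ * h := by
      rw [dist_comm, dist_eq_norm]
      exact hw4
    rw [Metric.mem_ball] at hAε ⊢
    have h3 := dist_triangle
      (HinfMin.hessian (fun μ => (S.reduced (R.V k) (R.W k) μ).sigma (w μ)) (R.μ k))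
      (HinfMin.hessian (fun μ => (S.full μ).hinfNorm) (R.μ k))
      (HinfMin.hessian (fun μ => (S.full μ).hinfNorm) μs)
    have h4 : ζ * h ≤ ζ * ρ₁ := by gcongr
    linarith
  have hB' := hKε hBε
  rw [hω]
  refine ⟨interior_mono (Metric.ball_subset_closedBall) (by
      rw [Metric.isOpen_ball.interior_eq]
      exact Metric.ball_subset_ball hρη.le hμkρ), w, hw1, hw2,
    (HinfMin.ParamSystem.contDiffAt_hinfNorm hpkb).of_le (by norm_num), hw3, ?_, hA.1, hB'.1, ?_⟩
  · exact hw4.trans (by gcongr)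
  · refine (HinfMin.norm_inv_sub_inv_le hA.1 hB'.1 hA.2 hB'.2).trans ?_
    calc _ ≤ K * (ζ * h) * K := by gcongr
      _ = K * ζ * K * h := by ring
      _ ≤ _ := by gcongr; exact le_max_right _ _
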